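/- Call a sequence of integers $(a_1,\dots,a_k,b_l,\dots,b_1)$ with $k,l\ge 1$ and $b_1<\dots<b_l<a_1<\dots<a_k$ a \emph{family}, with $k$ reds (the $a_i$) and $l$ blues (the $b_j$). \emph{Primitive} permutations of $\{1,\dots,n\}$ (in line notation), their active family $\mathcal A(\pi)$ and their buds are defined inductively. For $n=2$ the only primitive permutation is $\pi=(2,1)$, with $\mathcal A(\pi)=(2,1)$ and no buds. For $n>2$, $\pi$ is primitive if the permutation $\pi'$ obtained by removing $n$ is primitive and $n$ is immediately followed in $\pi$ by some $m\in\mathcal A(\pi')$; if $\mathcal A(\pi')$ with $n$ inserted immediately before $m$ is a family, this family is $\mathcal A(\pi)$ and the buds are those of $\pi'$; otherwise $\mathcal A(\pi)$ is $\mathcal A(\pi')$ with $m$ removed, and $(n,m)$ is a bud of $\pi$ in addition to those of $\pi'$. For $k,l\ge1$ and $b\ge0$ the number of primitive permutations with $k$ active reds, $l$ active blues and $b$ buds is finite and depends only on $k+l$ and $b$. Denote it by $n_{\rm prim}(k+l,b)$, put $n_{\rm prim}(f,b)=0$ for $f<2$, and let $$\Phi(x,t)=\sum_{f,b} n_{\rm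 prim}(f,b)\,x^{f}t^{b}\in\mathbb Q((t))[[x]],\qquad \varphi(t)=\frac12\left(\frac1t-\frac1{1-\frac1{\sum_{k\ge0}(2k-1)!!\,t^k}}\right)\in\mathbb Q((t)),$$ with $(-1)!!=1$, and $\psi(x)=\int_0^x e^{y^2}dy$. For real $t>0$ and real $x,c$ put $$K(x,t,c)=-x+\left(e^{\frac{1-(1-x)^2}{2t}}-1\right)(1-2tc)+2e^{-\frac{(1-x)^2}{2t}}\left(\psi\left(\tfrac{1-x}{\sqrt{2t}}\right)-\psi\left(\tfrac1{\sqrt{2t}}\right)\right)\frac{1-t-2tc}{\sqrt{2t}} .$$ Then: 1. (Closed form) $\Phi(x,t)=K(x,t,\varphi(t))$ in the following sense: there are polynomials $a_n$ with rational coefficients in $t$, $1/t$, $c$ such that $K(x,t,c)=\sum_{n\ge0}a_n(t,1/t,c)\,x^n$ for all real $t>0$ and all real $x,c$, and the coefficient of $x^n$ in $\Phi$ is the formal Laurent series $a_n(t,1/t,\varphi(t))$ for every $n$. 2. (Differential equation) $F=x^{-4}\Phi$ satisfies, in $\mathbb Q((t))((x))$, $$\frac{\partial F}{\partial x}=\frac{x-x^2-4t}{tx}F+\frac{2}{x^3}\varphi(t)-\frac1{tx^2},$$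 and, in $\mathbb Q((t))[[x]]$, $\ \dfrac{\partial\Phi}{\partial x}=\dfrac{1-x}{t}\Phi+2x\varphi(t)-\dfrac{x^2}{t}$. 3. (Boundary condition) $x^{-2}\Phi(x,t)$ is a power series in $x$ whose value at $x=0$ is $\varphi(t)$. 4. For every real $t>0$ and real $c$, the function $x\mapsto K(x,t,c)$ satisfies both equations of 2 with $c$ in place of $\varphi(t)$ (that for $\Phi$ at every real $x$, that for $x^{-4}\Phi$ at every $x\ne0$), and $\lim_{x\to0}x^{-2}K(x,t,c)=c$. -/

import Mathlib

namespace PrimPerm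

/-- `A` is a sequence family `(a₁, …, a_k, b_l, …, b₁)` with `k ≥ 1` ascent values (reds)
`a₁ < ⋯ < a_k` and `l ≥ 1` descent values (blues) `b₁ < ⋯ < b_l`, every red being larger than
every blue. -/
def IsFamilyWith (k l : ℕ) (A : List ℕ) : Prop :=
  1 ≤ k ∧ 1 ≤ l ∧ ∃ r b : List ℕ,
    r.length = k ∧ b.length = l ∧ A = r ++ b.reverse ∧
    r.Pairwise (· < ·) ∧ b.Pairwise (· < ·) ∧ ∀ x ∈ r, ∀ y ∈ b, y < x

/-- `A` is a (nonsinglet) sequence family. -/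
def IsFamily (A : List ℕ) : Prop := ∃ k l : ℕ, IsFamilyWith k l A

/-- `IsPrimitive π A B`: the permutation `π` of `{1, …, n}`, written in line notation, is
primitive, with active family `A` and list of buds `B`.

The permutation `(2, 1)` is primitive, is its own active family and has no buds. A primitive
permutation of `{1, …, n}`, `n > 2`, arises from a primitive permutation of `{1, …, n - 1}` by
inserting `n` immediately before an element `m` (the friend of `n`) of the active family.
If the active family with `n` inserted is a family, it is the new active family (`grow`).
Otherwise `m` is removed from the active family and `(n, m)` becomes a new bud (`bud`). -/
inductive IsPrimitive : List ℕ → List ℕ → List (ℕ × ℕ) → Prop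
  | base : IsPrimitive [2, 1] [2, 1] []
  | grow (n m : ℕ) (u v p q : List ℕ) (B : List (ℕ × ℕ)) :
      IsPrimitive (u ++ m :: v) (p ++ m :: q) B →
      n = (u ++ m :: v).length + 1 →
      IsFamily (p ++ n :: m :: q) →
      IsPrimitive (u ++ n :: m :: v) (p ++ n :: m :: q) B
  | bud (n m : ℕ) (u v p q : List ℕ) (B : List (ℕ × ℕ)) :
      IsPrimitive (u ++ m :: v) (p ++ m :: q) B →
      n = (u ++ m :: v).length + 1 →
      ¬ IsFamily (p ++ n :: m :: q) →
      IsPrimitive (u ++ n :: m :: v) (p ++ q) ((n, m) :: B)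

/-- The set of primitive permutations (of any size) whose active family has `k` reds and
`l` blues, and which have `b` buds. -/
def primitiveSet (k l b : ℕ) : Set (List ℕ) :=
  {π | ∃ (A : List ℕ) (B : List (ℕ × ℕ)),
    IsPrimitive π A B ∧ IsFamilyWith k l A ∧ B.length = b}

/-- The number of primitive permutations with `k` active reds, `l` active blues and `b` buds. -/
noncomputable def numPrimitive (k l b : ℕ) : ℕ := (primitiveSet k l b).ncard

/-- The number of primitive permutations with active family of size `f`, of any one given
coloring type (here: one red and `f - 1` blues), with `b` buds. It is `0` for `f < 2`. -/
noncomputable def nPrim (f b : ℕ) : ℕ := numPrimitive 1 (f - 1) b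

/-- The variable `t` of the field `ℚ((t))` of formal Laurent series. -/
noncomputable def t : LaurentSeries ℚ := HahnSeries.single 1 1

/-- The formal power series `∑ k, (2k-1)!! t^k`, where `(-1)!! = 1`. -/
noncomputable def pairings : LaurentSeries ℚ :=
  HahnSeries.ofPowerSeries ℤ ℚ
    (PowerSeries.mk fun k => (Nat.doubleFactorial (2 * k - 1) : ℚ))

/-- `φ(t) = ½ (1/t - 1/(1 - 1/∑ k, (2k-1)!! t^k))`, in the field `ℚ((t))`. -/
noncomputable def phi : LaurentSeries ℚ :=
  (1 / 2 : ℚ) • (1 / t - 1 / (1 - 1 / pairings))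

/-- The generating series `Φ(x, t) = ∑ nPrim f b x^f t^b`, as a power series in `x` over
`ℚ((t))`. -/
noncomputable def Phi : PowerSeries (LaurentSeries ℚ) :=
  PowerSeries.mk fun f =>
    HahnSeries.ofPowerSeries ℤ ℚ (PowerSeries.mk fun b => (nPrim f b : ℚ))

/-- `ψ(x) = ∫₀ˣ exp(y²) dy`, the imaginary error function up to normalization. -/
noncomputable def psi (x : ℝ) : ℝ := ∫ y in (0 : ℝ)..x, Real.exp (y ^ 2)

/-- The closed form, as a function of `x`, `t` and the value `c` of `φ(t)`. -/
noncomputable def closedForm (c t x : ℝ) : ℝ :=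
  -x + (Real.exp ((1 - (1 - x) ^ 2) / (2 * t)) - 1) * (1 - 2 * t * c)
    + 2 * Real.exp (-(1 - x) ^ 2 / (2 * t))
      * (psi ((1 - x) / Real.sqrt (2 * t)) - psi (1 / Real.sqrt (2 * t)))
      * ((1 - t - 2 * t * c) / Real.sqrt (2 * t))

/-- `IsExpansionAt K c S`: the series `S` in `x` over `ℚ((t))` is the Taylor expansion in `x` of
the function `K c t x`, in which the value of the parameter `c` is the Laurent series `c`.

That is, the `n`-th Taylor coefficient in `x` of `K` is a polynomial `a n` with rational
coefficients in `t`, `1/t` and `c` (for all real `c`, `x` and all real `t > 0`), and substituting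
in it the formal Laurent series `t`, `1/t` and `c` gives the `n`-th coefficient of `S`. -/
def IsExpansionAt (K : ℝ → ℝ → ℝ → ℝ) (c : LaurentSeries ℚ)
    (S : PowerSeries (LaurentSeries ℚ)) : Prop :=
  ∃ a : ℕ → MvPolynomial (Fin 3) ℚ,
    (∀ c' t' x : ℝ, 0 < t' →
      HasSum (fun n : ℕ => MvPolynomial.aeval ![t', 1 / t', c'] (a n) * x ^ n) (K c' t' x)) ∧
    ∀ n : ℕ, PowerSeries.coeff n S = MvPolynomial.aeval ![t, 1 / t, c] (a n)

/-- `x⁻⁴ Φ(x, t)`, as a Laurent series in `x` over `ℚ((t))`. -/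
noncomputable def Phi4 : LaurentSeries (LaurentSeries ℚ) :=
  HahnSeries.single (-4) 1 * HahnSeries.ofPowerSeries ℤ (LaurentSeries ℚ) Phi

/-- The variable `x` of the field `ℚ((t))((x))`. -/
noncomputable def x : LaurentSeries (LaurentSeries ℚ) := HahnSeries.single 1 1

/-- The constants `ℚ((t))` of the field `ℚ((t))((x))`. -/
noncomputable def C : LaurentSeries ℚ →+* LaurentSeries (LaurentSeries ℚ) := HahnSeries.C

end PrimPerm

/-!
The active family of a primitive permutation with `k` reds and `l` blues can receive the new maximum
before any of its `k + l` elements. Before the largest blue, or before a single red, the family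
grows; before one of several reds it loses a red; before a blue other than the largest one it loses
a blue (`child_mem_iff`). Since the permutation determines its history (`IsPrimitive.unique`), the
numbers of primitive permutations of each type satisfy a linear recurrence, and induction on the
size shows that they depend on `k + l` and the number of buds only (`numPrimitive_eq_nPrim`). What
remains is `n(f, b) = n(f - 1, b) + (f + 1) n(f + 1, b - 1)` for `f ≥ 2`, with an extra `1` at
`f = 2`, `b = 0` (`nPrim_recurrence`). Written for the generating series `Φ`, this is the
differential equation, with the coefficient of `x ^ 2` in `Φ` in the place of `φ(t)`.

That coefficient is found by exhibiting a second solution of the recurrence: the generating series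
`y_f` of partial matchings with `f` unmatched points satisfy `y_f = y_{f-1} + (f + 1) t y_{f+1}` for
every `f ≥ 1`, and `y_0 = 1 + t y_1`. In power series in `t` such a solution is determined by its
value at `f = 1`, so the coefficient of `x ^ f` in `Φ` is `y_f / y_1` for `f ≥ 2`
(`primSeries_mul_matchingSeries_one`). As `y_0 = ∑ (2k-1)!! t^k`, two steps of the recurrence
express `y_2 / y_1` through this series, and the result is `φ(t)` (`coeff_two_Phi`).

The closed form solves the same equation for real `t > 0`, with initial value `0`
(`hasDerivAt_closedForm`). The recurrence for Taylor coefficients that the equation encodes has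
polynomial solutions in `t`, `1/t`, `c`, and the resulting power series converges on the whole line
to a solution, which is the closed form by uniqueness (`hasSum_closedForm`). The coefficients of `Φ`
satisfy the same recurrence with `c = φ(t)`.
-/

namespace PrimPerm

/-! ### Families and the insertion of a new maximum -/

/-- Being a family, by positions: the entries before position `k` increase, and every entry from
position `k` on is smaller than all entries before it. -/
theorem isFamilyWith_iff {k l : ℕ} {A : List ℕ} :
    IsFamilyWith k l A ↔ 1 ≤ k ∧ 1 ≤ l ∧ A.length = k + l ∧
      ∀ i j, i < j → j < k + l →
        if j < k then A.getD i 0 < A.getD j 0 else A.getD j 0 < A.getD i 0 := by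
  constructor
  · rintro ⟨hk, hl, r, b, rfl, rfl, rfl, hr, hb, hrb⟩
    rw [List.pairwise_iff_getElem] at hr hb
    refine ⟨hk, hl, by simp, fun i j hij hj => ?_⟩
    have hj' : j < (r ++ b.reverse).length := by simpa using hj
    rw [List.getD_eq_getElem _ _ hj', List.getD_eq_getElem _ _ (hij.trans hj')]
    split_ifs with h
    · rw [List.getElem_append_left h, List.getElem_append_left (hij.trans h)]
      exact hr _ _ _ _ hij
    · rw [List.getElem_append_right (not_lt.1 h), List.getElem_reverse]
      by_cases hi : i < r.length
      · rw [List.getElem_append_left hi]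
        exact hrb _ (List.getElem_mem _) _ (List.getElem_mem _)
      · rw [List.getElem_append_right (not_lt.1 hi), List.getElem_reverse]
        exact hb _ _ _ _ (by omega)
  · rintro ⟨hk, hl, hlen, h⟩
    refine ⟨hk, hl, A.take k, (A.drop k).reverse, by simp; omega, by simp; omega, by simp,
      ?_, ?_, ?_⟩
    · rw [List.pairwise_iff_getElem]
      intro i j hi hj hij
      simp only [List.length_take] at hi hj
      have := h i j hij (by omega)
      rw [if_pos (by omega), List.getD_eq_getElem _ _ (by omega),
        List.getD_eq_getElem _ _ (by omega)] at this
      simpa using this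
    · rw [List.pairwise_reverse, List.pairwise_iff_getElem]
      intro i j hi hj hij
      simp only [List.length_drop] at hi hj
      have := h (k + i) (k + j) (by omega) (by omega)
      rw [if_neg (by omega), List.getD_eq_getElem _ _ (by omega),
        List.getD_eq_getElem _ _ (by omega)] at this
      simpa using this
    · intro x hx y hy
      rw [List.mem_reverse] at hy
      obtain ⟨i, hi, rfl⟩ := List.getElem_of_mem hx
      obtain ⟨j, hj, rfl⟩ := List.getElem_of_mem hy
      simp only [List.length_take] at hi
      simp only [List.length_drop] at hj
      have := h i (k + j) (by omega) (by omega)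
      rw [if_neg (by omega), List.getD_eq_getElem _ _ (by omega),
        List.getD_eq_getElem _ _ (by omega)] at this
      simpa using this

theorem getD_insertIdx {A : List ℕ} {i n : ℕ} (hi : i ≤ A.length) (j : ℕ) :
    (A.insertIdx i n).getD j 0 =
      if j < i then A.getD j 0 else if j = i then n else A.getD (j - 1) 0 := by
  simp only [List.getD_eq_getElem?_getD, List.getElem?_insertIdx]
  grind

theorem getD_eraseIdx {A : List ℕ} {i : ℕ} (j : ℕ) :
    (A.eraseIdx i).getD j 0 = if j < i then A.getD j 0 else A.getD (j + 1) 0 := by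
  simp only [List.getD_eq_getElem?_getD, List.getElem?_eraseIdx]
  grind

theorem IsFamilyWith.length_eq {k l : ℕ} {A : List ℕ} (h : IsFamilyWith k l A) :
    A.length = k + l := (isFamilyWith_iff.1 h).2.2.1

theorem IsFamilyWith.one_le_left {k l : ℕ} {A : List ℕ} (h : IsFamilyWith k l A) : 1 ≤ k := h.1

theorem IsFamilyWith.one_le_right {k l : ℕ} {A : List ℕ} (h : IsFamilyWith k l A) : 1 ≤ l := h.2.1

/-- The last red is the maximum of the family, so its position determines the number of reds. -/
theorem IsFamilyWith.unique {k l k' l' : ℕ} {A : List ℕ} (h : IsFamilyWith k l A)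
    (h' : IsFamilyWith k' l' A) : k = k' ∧ l = l' := by
  rw [isFamilyWith_iff] at h h'
  obtain ⟨hk, hl, hA, h⟩ := h
  obtain ⟨hk', hl', hA', h'⟩ := h'
  have h1 := h (k - 1) k (by omega) (by omega)
  have h2 := h' (k' - 1) k' (by omega) (by omega)
  have h3 := h' (k - 1) k (by omega) (by omega)
  have h4 := h (k' - 1) k' (by omega) (by omega)
  grind

theorem IsFamilyWith.getD_injective {k l : ℕ} {A : List ℕ} (h : IsFamilyWith k l A) {i j : ℕ}
    (hi : i < k + l) (hj : j < k + l) (hij : A.getD i 0 = A.getD j 0) : i = j := by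
  obtain ⟨-, -, -, h⟩ := isFamilyWith_iff.1 h
  rcases lt_trichotomy i j with h1 | h1 | h1
  · have := h i j h1 hj
    grind
  · exact h1
  · have := h j i h1 hi
    grind

theorem getD_lt_of_forall_lt {A : List ℕ} {n : ℕ} (hn : ∀ a ∈ A, a < n) {i : ℕ}
    (hi : i < A.length) :
    A.getD i 0 < n := by
  rw [List.getD_eq_getElem _ _ hi]
  exact hn _ (List.getElem_mem _)

theorem IsFamilyWith.insertIdx_red {k l n : ℕ} {A : List ℕ} (h : IsFamilyWith k l A)
    (hn : ∀ a ∈ A, a < n) : IsFamilyWith (k + 1) l (A.insertIdx k n) := by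
  have hlt := fun i => getD_lt_of_forall_lt hn (i := i)
  rw [isFamilyWith_iff] at h ⊢
  obtain ⟨hk, hl, hA, h⟩ := h
  refine ⟨by omega, hl, by rw [List.length_insertIdx_of_le_length (by omega)]; omega, ?_⟩
  intro i j hij hj
  have hkA : k ≤ A.length := by omega
  rw [getD_insertIdx hkA, getD_insertIdx hkA]
  have h1 := h i j
  have h2 := h i (j - 1)
  have h3 := h (i - 1) (j - 1)
  have h4 := hlt i
  have h5 := hlt (j - 1)
  grind

theorem IsFamilyWith.insertIdx_blue {l n : ℕ} {A : List ℕ} (h : IsFamilyWith 1 l A)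
    (hn : ∀ a ∈ A, a < n) : IsFamilyWith 1 (l + 1) (A.insertIdx 0 n) := by
  have hlt := fun i => getD_lt_of_forall_lt hn (i := i)
  rw [isFamilyWith_iff] at h ⊢
  obtain ⟨hk, hl, hA, h⟩ := h
  refine ⟨by omega, by omega, by rw [List.length_insertIdx_of_le_length (by omega)]; omega, ?_⟩
  intro i j hij hj
  rw [getD_insertIdx (Nat.zero_le _), getD_insertIdx (Nat.zero_le _)]
  have h3 := h (i - 1) (j - 1)
  have h5 := hlt (j - 1)
  grind

theorem IsFamilyWith.eraseIdx_red {k l i : ℕ} {A : List ℕ} (h : IsFamilyWith k l A)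
    (hk : 2 ≤ k) (hi : i < k) : IsFamilyWith (k - 1) l (A.eraseIdx i) := by
  rw [isFamilyWith_iff] at h ⊢
  obtain ⟨-, hl, hA, h⟩ := h
  refine ⟨by omega, hl, by rw [List.length_eraseIdx_of_lt (by omega)]; omega, ?_⟩
  intro a b hab hb
  rw [getD_eraseIdx, getD_eraseIdx]
  have h1 := h a b
  have h2 := h a (b + 1)
  have h3 := h (a + 1) (b + 1)
  grind

theorem IsFamilyWith.eraseIdx_blue {k l i : ℕ} {A : List ℕ} (h : IsFamilyWith k l A)
    (hl : 2 ≤ l) (hi : k ≤ i) (hi' : i < k + l) : IsFamilyWith k (l - 1) (A.eraseIdx i) := by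
  rw [isFamilyWith_iff] at h ⊢
  obtain ⟨hk, -, hA, h⟩ := h
  refine ⟨by omega, by omega, by rw [List.length_eraseIdx_of_lt (by omega)]; omega, ?_⟩
  intro a b hab hb
  rw [getD_eraseIdx, getD_eraseIdx]
  have h1 := h a b
  have h2 := h a (b + 1)
  have h3 := h (a + 1) (b + 1)
  grind

/-- A new maximum is compatible with the family only just before the largest blue, or just before
a single red. -/
theorem IsFamilyWith.of_insertIdx {k l i n : ℕ} {A : List ℕ} (h : IsFamilyWith k l A)
    (hn : ∀ a ∈ A, a < n) (hi : i < k + l) (hf : IsFamily (A.insertIdx i n)) :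
    i = k ∨ (k = 1 ∧ i = 0) := by
  have hlt := fun i => getD_lt_of_forall_lt hn (i := i)
  obtain ⟨k', l', hf⟩ := hf
  rw [isFamilyWith_iff] at h hf
  obtain ⟨hk, hl, hA, h⟩ := h
  obtain ⟨hk', hl', hA', hf⟩ := hf
  rw [List.length_insertIdx_of_le_length (by omega)] at hA'
  have hiA : i ≤ A.length := by omega
  simp only [getD_insertIdx hiA] at hf
  -- the new maximum must be the last red
  have hik : i + 1 = k' := by
    have h1 := hf i (i + 1)
    have h2 := hf 0 i
    have h3 := hlt i
    have h4 := hlt 0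
    grind
  by_contra hcon
  rcases lt_or_gt_of_ne (show i ≠ k by tauto) with hik' | hik'
  · have h1 := hf 0 (i + 1)
    have h2 := hf 1 2
    have h3 := h 0 i
    have h4 := h 0 1
    grind
  · have h1 := hf (k - 1) k
    have h2 := h (k - 1) k
    grind

/-! ### A primitive permutation determines its history -/

/-- Insertion of `n` immediately before the first occurrence of `m` in `π` (at the end, if `m` does
not occur). -/
def insertBefore (n m : ℕ) (π : List ℕ) : List ℕ := π.insertIdx (π.idxOf m) n

theorem insertIdx_length_append (u v : List ℕ) (n : ℕ) :
    (u ++ v).insertIdx u.length n = u ++ n :: v := by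
  induction u with
  | nil => simp
  | cons a u ih => simpa using ih

theorem insertBefore_append {n m : ℕ} {u v : List ℕ} (hm : m ∉ u) :
    insertBefore n m (u ++ m :: v) = u ++ n :: m :: v := by
  rw [insertBefore, List.idxOf_append_of_notMem hm, List.idxOf_cons_self, add_zero,
    insertIdx_length_append]

theorem eq_take_append_getD_cons_drop {A : List ℕ} {i : ℕ} (hi : i < A.length) :
    A = A.take i ++ A.getD i 0 :: A.drop (i + 1) := by
  rw [List.getD_eq_getElem _ _ hi, ← List.drop_eq_getElem_cons hi, List.take_append_drop]

theorem insertIdx_eq_take_append {A : List ℕ} {i n : ℕ} (hi : i < A.length) :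
    A.insertIdx i n = A.take i ++ n :: A.getD i 0 :: A.drop (i + 1) := by
  have h := insertIdx_length_append (A.take i) (A.getD i 0 :: A.drop (i + 1)) n
  rwa [← eq_take_append_getD_cons_drop hi, List.length_take, min_eq_left hi.le] at h

theorem append_cons_inj {a : ℕ} {u v u' v' : List ℕ} (hu : a ∉ u) (hu' : a ∉ u')
    (h : u ++ a :: v = u' ++ a :: v') : u = u' ∧ v = v' := by
  induction u generalizing u' with
  | nil => cases u' with
    | nil => simpa using h
    | cons b u' => grind
  | cons b u ih => cases u' with
    | nil => grind
    | cons c u' =>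
      simp only [List.cons_append, List.cons.injEq] at h
      have := ih (by grind) (u' := u') (by grind) h.2
      grind

/-- What is needed of a primitive permutation, its active family and its buds. -/
theorem IsPrimitive.invariants {π A : List ℕ} {B : List (ℕ × ℕ)} (h : IsPrimitive π A B) :
    π.Nodup ∧ (∀ a ∈ π, a ≤ π.length) ∧ A ⊆ π ∧ IsFamily A ∧ 2 ≤ π.length := by
  induction h with
  | base =>
    refine ⟨by simp, by simp, by simp, ⟨1, 1, le_rfl, le_rfl, [2], [1], ?_⟩, by simp⟩
    simp
  | grow n m u v p q B _ hn hf ih =>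
    obtain ⟨h1, h2, h3, h4, h5⟩ := ih
    have hnot : n ∉ u ++ m :: v := fun hmem => by have := h2 n hmem; omega
    refine ⟨?_, ?_, ?_, hf, ?_⟩
    · rw [List.nodup_middle, List.nodup_cons]
      exact ⟨hnot, h1⟩
    · intro a ha
      have := h2 a
      grind
    · intro a ha
      have := @h3 a
      grind
    · grind
  | bud n m u v p q B _ hn hf ih =>
    obtain ⟨h1, h2, h3, ⟨k, l, h4⟩, h5⟩ := ih
    have hnot : n ∉ u ++ m :: v := fun hmem => by have := h2 n hmem; omega
    have hA : ∀ a ∈ p ++ m :: q, a < n := fun a ha => by have := h2 a (h3 ha); omega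
    have hlen := h4.length_eq
    simp only [List.length_append, List.length_cons] at hlen
    have hins : p ++ n :: m :: q = (p ++ m :: q).insertIdx p.length n :=
      (insertIdx_length_append _ _ _).symm
    have her : p ++ q = (p ++ m :: q).eraseIdx p.length := by
      simp [List.eraseIdx_append_of_length_le]
    have hk1 := h4.one_le_left
    have hl1 := h4.one_le_right
    refine ⟨?_, ?_, ?_, ?_, ?_⟩
    · rw [List.nodup_middle, List.nodup_cons]
      exact ⟨hnot, h1⟩
    · intro a ha
      have := h2 a
      grind
    · intro a ha
      have := @h3 a
      grind
    · rw [hins] at hf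
      rw [her]
      rcases lt_trichotomy p.length k with hk | hk | hk
      · by_cases hk' : 2 ≤ k
        · exact ⟨_, _, h4.eraseIdx_red hk' hk⟩
        · obtain rfl : k = 1 := by omega
          have hp : p.length = 0 := by omega
          rw [hp] at hf
          exact absurd ⟨_, _, h4.insertIdx_blue hA⟩ hf
      · rw [hk] at hf
        exact absurd ⟨_, _, h4.insertIdx_red hA⟩ hf
      · exact ⟨_, _, h4.eraseIdx_blue (by omega) hk.le (by omega)⟩
    · grind

theorem IsPrimitive.lt_length_add_one {π A : List ℕ} {B : List (ℕ × ℕ)} (h : IsPrimitive π A B) :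
    ∀ a ∈ A, a < π.length + 1 :=
  fun a ha => Nat.lt_succ_of_le (h.invariants.2.1 a (h.invariants.2.2.1 ha))

/-- The permutation without its maximum, and the element that follows the maximum, can be read
off from the permutation. -/
theorem insertBefore_injective {π π' : List ℕ} {m m' : ℕ} (hπ : ∀ a ∈ π, a ≤ π.length)
    (hπ' : ∀ a ∈ π', a ≤ π'.length) (hm : m ∈ π) (hm' : m' ∈ π')
    (h : insertBefore (π.length + 1) m π = insertBefore (π'.length + 1) m' π') :
    π = π' ∧ m = m' := by
  obtain ⟨u, v, rfl, hu⟩ := List.eq_append_cons_of_mem hm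
  obtain ⟨u', v', rfl, hu'⟩ := List.eq_append_cons_of_mem hm'
  rw [insertBefore_append hu, insertBefore_append hu'] at h
  have hlen := congrArg List.length h
  simp only [List.length_append, List.length_cons] at hlen h hπ hπ'
  rw [show u'.length + (v'.length + 1) + 1 = u.length + (v.length + 1) + 1 by omega] at h
  obtain ⟨rfl, h2⟩ := append_cons_inj
    (fun hmem => by have := hπ _ (List.mem_append_left _ hmem); omega)
    (fun hmem => by have := hπ' _ (List.mem_append_left _ hmem); omega) h
  simp only [List.cons.injEq] at h2
  grind

theorem IsPrimitive.getD_mem {π A : List ℕ} {B : List (ℕ × ℕ)} (h : IsPrimitive π A B) {i : ℕ}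
    (hi : i < A.length) : A.getD i 0 ∈ π := by
  rw [List.getD_eq_getElem _ _ hi]
  exact h.invariants.2.2.1 (List.getElem_mem _)

/-- The last insertion: the friend of the maximum is described by its position `i` in the active
family. -/
theorem IsPrimitive.last_insertion {π A : List ℕ} {B : List (ℕ × ℕ)} (h : IsPrimitive π A B) :
    (π = [2, 1] ∧ A = [2, 1] ∧ B = []) ∨
    ∃ (π' A' : List ℕ) (B' : List (ℕ × ℕ)) (i : ℕ), IsPrimitive π' A' B' ∧ i < A'.length ∧
      π = insertBefore (π'.length + 1) (A'.getD i 0) π' ∧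
      ((IsFamily (A'.insertIdx i (π'.length + 1)) ∧ A = A'.insertIdx i (π'.length + 1) ∧
          B = B') ∨
        (¬ IsFamily (A'.insertIdx i (π'.length + 1)) ∧ A = A'.eraseIdx i ∧
          B = (π'.length + 1, A'.getD i 0) :: B')) := by
  cases h with
  | base => simp
  | grow n m u v p q B hp hn hf =>
    have hu : m ∉ u := by have := hp.invariants.1; grind
    refine Or.inr ⟨_, _, _, p.length, hp, by simp, ?_, Or.inl ?_⟩
    · simp [insertBefore_append hu, hn]
    · rw [insertIdx_length_append, ← hn]
      exact ⟨hf, rfl, rfl⟩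
  | bud n m u v p q B hp hn hf =>
    have hu : m ∉ u := by have := hp.invariants.1; grind
    refine Or.inr ⟨_, _, _, p.length, hp, by simp, ?_, Or.inr ?_⟩
    · simp [insertBefore_append hu, hn]
    · rw [insertIdx_length_append, ← hn]
      exact ⟨hf, by simp [List.eraseIdx_append_of_length_le], by simp⟩

theorem length_insertBefore {n m : ℕ} {π : List ℕ} :
    (insertBefore n m π).length = π.length + 1 :=
  List.length_insertIdx_of_le_length List.idxOf_le_length _

/-- A primitive permutation determines the last insertion. -/
theorem IsPrimitive.insertBefore_injective {π A π' A' : List ℕ} {B B' : List (ℕ × ℕ)}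
    (h : IsPrimitive π A B) (h' : IsPrimitive π' A' B') {i i' : ℕ} (hi : i < A.length)
    (hi' : i' < A'.length)
    (heq : insertBefore (π.length + 1) (A.getD i 0) π =
      insertBefore (π'.length + 1) (A'.getD i' 0) π') :
    π = π' ∧ A.getD i 0 = A'.getD i' 0 :=
  PrimPerm.insertBefore_injective h.invariants.2.1 h'.invariants.2.1 (h.getD_mem hi)
    (h'.getD_mem hi') heq

/-- The active family and the buds depend on the permutation alone. -/
theorem IsPrimitive.unique {π A A' : List ℕ} {B B' : List (ℕ × ℕ)} (h : IsPrimitive π A B)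
    (h' : IsPrimitive π A' B') : A = A' ∧ B = B' := by
  induction hN : π.length generalizing π A A' B B' with
  | zero => have := h.invariants.2.2.2.2; omega
  | succ N ih =>
    rcases h.last_insertion with ⟨h1, rfl, rfl⟩ | ⟨π₁, A₁, B₁, i, hp, hi, rfl, hcase⟩
    · rcases h'.last_insertion with ⟨h1', rfl, rfl⟩ | ⟨π₂, A₂, B₂, i', hp', hi', h2, -⟩
      · simp
      · have := hp'.invariants.2.2.2.2
        rw [h2] at h1
        have := congrArg List.length h1
        rw [length_insertBefore] at this
        grind
    · have hlen := length_insertBefore (n := π₁.length + 1) (m := A₁.getD i 0) (π := π₁)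
      rcases h'.last_insertion with ⟨h1', rfl, rfl⟩ | ⟨π₂, A₂, B₂, i', hp', hi', h2, hcase'⟩
      · have := hp.invariants.2.2.2.2
        rw [h1'] at hlen
        simp only [List.length_cons, List.length_nil] at hlen
        omega
      · obtain ⟨rfl, hm⟩ := hp.insertBefore_injective hp' hi hi' h2
        obtain ⟨rfl, rfl⟩ := ih hp hp' (by omega)
        obtain ⟨k, l, hA⟩ := hp.invariants.2.2.2.1
        obtain rfl := hA.getD_injective (hA.length_eq ▸ hi) (hA.length_eq ▸ hi') hm
        grind

/-! ### Counting primitive permutations -/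

/-- A permutation together with its active family and its buds. -/
abbrev State := List ℕ × List ℕ × List (ℕ × ℕ)

/-- The triples `(π, A, B)` with `π` primitive, `A` its active family, with `k` reds and `l` blues,
and `B` its list of `b` buds. -/
def primitiveStates (k l b : ℕ) : Set State :=
  {s | IsPrimitive s.1 s.2.1 s.2.2 ∧ IsFamilyWith k l s.2.1 ∧ s.2.2.length = b}

/-- The permutation obtained by inserting the new maximum immediately before the entry at position
`i` of the active family, for a pair `(s, i)`. It is meant for `i` smaller than the size of the
active family; the default value `0` of `List.getD` plays no role. -/
def child (s : State × ℕ) : List ℕ :=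
  insertBefore (s.1.1.length + 1) (s.1.2.1.getD s.2 0) s.1.1

theorem mem_primitiveSet_iff {k l b : ℕ} {π : List ℕ} :
    π ∈ primitiveSet k l b ↔ ∃ A B, (π, A, B) ∈ primitiveStates k l b := Iff.rfl

theorem image_fst_primitiveStates (k l b : ℕ) :
    Prod.fst '' primitiveStates k l b = primitiveSet k l b := by
  ext π
  simp [mem_primitiveSet_iff]

theorem injOn_fst_primitiveStates (k l b : ℕ) :
    Set.InjOn Prod.fst (primitiveStates k l b) := by
  rintro ⟨π, A, B⟩ h ⟨π', A', B'⟩ h' (rfl : π = π')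
  obtain ⟨h1, h2⟩ := h.1.unique h'.1
  simp only at h1 h2
  rw [h1, h2]

theorem ncard_primitiveStates (k l b : ℕ) :
    (primitiveStates k l b).ncard = numPrimitive k l b := by
  rw [numPrimitive, ← image_fst_primitiveStates, (injOn_fst_primitiveStates k l b).ncard_image]

theorem primitiveSet_type_unique {k l b k' l' b' : ℕ} {π : List ℕ} (h : π ∈ primitiveSet k l b)
    (h' : π ∈ primitiveSet k' l' b') : k = k' ∧ l = l' ∧ b = b' := by
  obtain ⟨A, B, h1, h2, h3⟩ := h
  obtain ⟨A', B', h1', h2', h3'⟩ := h'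
  obtain ⟨rfl, rfl⟩ := h1.unique h1'
  have := h2.unique h2'
  exact ⟨this.1, this.2, h3.symm.trans h3'⟩

theorem child_eq_append {π A u v : List ℕ} {B : List (ℕ × ℕ)} {i : ℕ}
    (hπ : π = u ++ A.getD i 0 :: v) (hu : A.getD i 0 ∉ u) :
    child ((π, A, B), i) = u ++ (π.length + 1) :: A.getD i 0 :: v := by
  rw [← insertBefore_append hu, ← hπ]
  rfl

theorem isPrimitive_child_of_isFamily {π A : List ℕ} {B : List (ℕ × ℕ)} (h : IsPrimitive π A B)
    {i : ℕ} (hi : i < A.length) (hf : IsFamily (A.insertIdx i (π.length + 1))) :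
    IsPrimitive (child ((π, A, B), i)) (A.insertIdx i (π.length + 1)) B := by
  obtain ⟨u, v, huv, hu⟩ := List.eq_append_cons_of_mem (h.getD_mem hi)
  have h' : IsPrimitive (u ++ A.getD i 0 :: v) (A.take i ++ A.getD i 0 :: A.drop (i + 1)) B := by
    rwa [← huv, ← eq_take_append_getD_cons_drop hi]
  rw [insertIdx_eq_take_append hi] at hf ⊢
  rw [child_eq_append huv hu]
  exact h'.grow _ _ _ _ _ _ _ (by rw [← huv]) hf

theorem isPrimitive_child_of_not_isFamily {π A : List ℕ} {B : List (ℕ × ℕ)}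
    (h : IsPrimitive π A B) {i : ℕ} (hi : i < A.length)
    (hf : ¬ IsFamily (A.insertIdx i (π.length + 1))) :
    IsPrimitive (child ((π, A, B), i)) (A.eraseIdx i) ((π.length + 1, A.getD i 0) :: B) := by
  obtain ⟨u, v, huv, hu⟩ := List.eq_append_cons_of_mem (h.getD_mem hi)
  have h' : IsPrimitive (u ++ A.getD i 0 :: v) (A.take i ++ A.getD i 0 :: A.drop (i + 1)) B := by
    rwa [← huv, ← eq_take_append_getD_cons_drop hi]
  rw [insertIdx_eq_take_append hi] at hf
  rw [child_eq_append huv hu, List.eraseIdx_eq_take_drop_succ]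
  exact h'.bud _ _ _ _ _ _ _ (by rw [← huv]) hf

/-- The type of the permutation after one insertion, according to the position `i` of the friend of
the new maximum. -/
theorem child_mem_iff {k l b : ℕ} {s : State} (hs : s ∈ primitiveStates k l b) {i : ℕ}
    (hi : i < k + l) {k' l' b' : ℕ} :
    child (s, i) ∈ primitiveSet k' l' b' ↔
      (i = k ∧ k' = k + 1 ∧ l' = l ∧ b' = b) ∨
      (i = 0 ∧ k = 1 ∧ k' = 1 ∧ l' = l + 1 ∧ b' = b) ∨
      (i < k ∧ 1 ≤ k' ∧ k = k' + 1 ∧ l' = l ∧ b' = b + 1) ∨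
      (k < i ∧ k' = k ∧ l = l' + 1 ∧ b' = b + 1) := by
  obtain ⟨π, A, B⟩ := s
  obtain ⟨hp, hA, hB⟩ := hs
  simp only at hp hA hB
  have hiA : i < A.length := hA.length_eq ▸ hi
  have hlt := hp.lt_length_add_one
  have hk1 := hA.one_le_left
  have hl1 := hA.one_le_right
  rcases lt_trichotomy i k with hik | hik | hik
  · by_cases hk : k = 1
    · subst hk
      obtain rfl : i = 0 := by omega
      have hf := hA.insertIdx_blue hlt
      have hmem : child ((π, A, B), 0) ∈ primitiveSet 1 (l + 1) b :=
        ⟨_, _, isPrimitive_child_of_isFamily hp hiA ⟨_, _, hf⟩, hf, hB⟩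
      refine ⟨fun h => ?_, fun h => ?_⟩
      · have := primitiveSet_type_unique hmem h
        omega
      · obtain ⟨rfl, rfl, rfl⟩ : k' = 1 ∧ l' = l + 1 ∧ b' = b := by omega
        exact hmem
    · have hmem : child ((π, A, B), i) ∈ primitiveSet (k - 1) l (b + 1) :=
        ⟨_, _, isPrimitive_child_of_not_isFamily hp hiA fun hf => by
          have := hA.of_insertIdx hlt hi hf
          omega, hA.eraseIdx_red (by omega) hik, by simp [hB]⟩
      refine ⟨fun h => ?_, fun h => ?_⟩
      · have := primitiveSet_type_unique hmem h
        omega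
      · obtain ⟨rfl, rfl, rfl⟩ : k' = k - 1 ∧ l' = l ∧ b' = b + 1 := by omega
        exact hmem
  · subst hik
    have hf := hA.insertIdx_red hlt
    have hmem : child ((π, A, B), i) ∈ primitiveSet (i + 1) l b :=
      ⟨_, _, isPrimitive_child_of_isFamily hp hiA ⟨_, _, hf⟩, hf, hB⟩
    refine ⟨fun h => ?_, fun h => ?_⟩
    · have := primitiveSet_type_unique hmem h
      omega
    · obtain ⟨rfl, rfl, rfl⟩ : k' = i + 1 ∧ l' = l ∧ b' = b := by omega
      exact hmem
  · have hmem : child ((π, A, B), i) ∈ primitiveSet k (l - 1) (b + 1) :=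
      ⟨_, _, isPrimitive_child_of_not_isFamily hp hiA fun hf => by
        have := hA.of_insertIdx hlt hi hf
        omega, hA.eraseIdx_blue (by omega) hik.le hi, by simp [hB]⟩
    refine ⟨fun h => ?_, fun h => ?_⟩
    · have := primitiveSet_type_unique hmem h
      omega
    · obtain ⟨rfl, rfl, rfl⟩ : k' = k ∧ l' = l - 1 ∧ b' = b + 1 := by omega
      exact hmem

theorem exists_eq_child {k l b : ℕ} {π : List ℕ} (h : π ∈ primitiveSet k l b) :
    (π = [2, 1] ∧ k = 1 ∧ l = 1 ∧ b = 0) ∨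
    ∃ (k' l' b' : ℕ) (s : State) (i : ℕ), s ∈ primitiveStates k' l' b' ∧ i < k' + l' ∧
      π = child (s, i) := by
  obtain ⟨A, B, hp, hA, hB⟩ := h
  rcases hp.last_insertion with ⟨rfl, rfl, rfl⟩ | ⟨π', A', B', i, hp', hi, rfl, -⟩
  · have h21 : IsFamilyWith 1 1 [2, 1] := ⟨le_rfl, le_rfl, [2], [1], by simp⟩
    have := hA.unique h21
    exact Or.inl ⟨rfl, this.1, this.2, hB.symm⟩
  · obtain ⟨k', l', hA'⟩ := hp'.invariants.2.2.2.1
    exact Or.inr ⟨k', l', B'.length, (π', A', B'), i, ⟨hp', hA', rfl⟩, hA'.length_eq ▸ hi, rfl⟩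

/-- The insertions that lead to a given type and enlarge the active family: if the result
has at least two reds, the maximum has become the last of them, having been inserted before the
largest blue, at position `k - 1`; otherwise it has been inserted at position `0`, before a single
red, which has thereby turned blue. -/
def growPairs (k l b : ℕ) : Set (State × ℕ) :=
  if 2 ≤ k then primitiveStates (k - 1) l b ×ˢ {k - 1} else primitiveStates 1 (l - 1) b ×ˢ {0}

/-- The insertions that lead to a given type with `b + 1` buds and create a bud from a red. -/
def budRedPairs (k l b : ℕ) : Set (State × ℕ) := primitiveStates (k + 1) l b ×ˢ Set.Iio (k + 1)

/-- The insertions that lead to a given type with `b + 1` buds and create a bud from a blue,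
which can be any blue but the largest one, at position `k`. -/
def budBluePairs (k l b : ℕ) : Set (State × ℕ) :=
  primitiveStates k (l + 1) b ×ˢ Set.Ioo k (k + l + 1)

/-- The insertions that lead to a given type and create a bud. -/
def budPairs (k l : ℕ) : ℕ → Set (State × ℕ)
  | 0 => ∅
  | b + 1 => budRedPairs k l b ∪ budBluePairs k l b

/-- A permutation comes from one insertion only: its maximum, the friend of the maximum and, by
`IsPrimitive.unique`, the previous active family and buds can be read off from it. -/
theorem injOn_child :
    Set.InjOn child {s : State × ℕ | IsPrimitive s.1.1 s.1.2.1 s.1.2.2 ∧ s.2 < s.1.2.1.length} := by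
  rintro ⟨⟨π, A, B⟩, i⟩ ⟨h, hi⟩ ⟨⟨π', A', B'⟩, i'⟩ ⟨h', hi'⟩ heq
  simp only at h hi h' hi'
  obtain ⟨rfl, hm⟩ := h.insertBefore_injective h' hi hi' heq
  obtain ⟨rfl, rfl⟩ := h.unique h'
  obtain ⟨k, l, hA⟩ := h.invariants.2.2.2.1
  rw [hA.getD_injective (hA.length_eq ▸ hi) (hA.length_eq ▸ hi') hm]

theorem mem_pairs {k l b : ℕ} (hk1 : 1 ≤ k) (hl1 : 1 ≤ l) {s : State × ℕ}
    (hs : s ∈ growPairs k l b ∪ budPairs k l b) :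
    ∃ k' l' b', s.1 ∈ primitiveStates k' l' b' ∧ s.2 < k' + l' ∧
      child s ∈ primitiveSet k l b := by
  have hone : ∀ {k' l' b' : ℕ} {s : State}, s ∈ primitiveStates k' l' b' → 1 ≤ k' ∧ 1 ≤ l' :=
    fun h => ⟨h.2.1.one_le_left, h.2.1.one_le_right⟩
  obtain ⟨s, i⟩ := s
  rcases hs with hs | hs
  · unfold growPairs at hs
    split_ifs at hs with hk
    · obtain ⟨hs, rfl : i = k - 1⟩ := hs
      have := hone hs
      refine ⟨_, _, _, hs, by simp only; omega, ?_⟩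
      rw [child_mem_iff hs (by omega)]
      omega
    · obtain ⟨hs, rfl : i = 0⟩ := hs
      have := hone hs
      refine ⟨_, _, _, hs, by simp only; omega, ?_⟩
      rw [child_mem_iff hs (by omega)]
      omega
  · cases b with
    | zero => exact hs.elim
    | succ b =>
      rcases hs with ⟨hs, hi⟩ | ⟨hs, hi⟩
      · have := hone hs
        simp only [Set.mem_Iio] at hi hs
        refine ⟨_, _, _, hs, by simp only; omega, ?_⟩
        rw [child_mem_iff hs (by omega)]
        omega
      · have := hone hs
        simp only [Set.mem_Ioo] at hi hs
        refine ⟨_, _, _, hs, by simp only; omega, ?_⟩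
        rw [child_mem_iff hs (by omega)]
        omega

theorem primitiveSet_eq {k l b : ℕ} (hk1 : 1 ≤ k) (hl1 : 1 ≤ l) :
    primitiveSet k l b = (if k = 1 ∧ l = 1 ∧ b = 0 then {[2, 1]} else ∅) ∪
      child '' (growPairs k l b ∪ budPairs k l b) := by
  ext π
  constructor
  · intro hπ
    rcases exists_eq_child hπ with ⟨rfl, rfl, rfl, rfl⟩ | ⟨k', l', b', s, i, hs, hi, rfl⟩
    · left
      simp
    · right
      refine ⟨(s, i), ?_, rfl⟩
      have hk' := hs.2.1.one_le_left
      have hl' := hs.2.1.one_le_right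
      rcases (child_mem_iff hs hi).1 hπ with h | h | h | h
      · obtain ⟨rfl, rfl, rfl, rfl⟩ := h
        left
        rw [growPairs, if_pos (by omega)]
        exact ⟨hs, rfl⟩
      · obtain ⟨rfl, rfl, rfl, rfl, rfl⟩ := h
        left
        rw [growPairs, if_neg (by omega)]
        exact ⟨hs, rfl⟩
      · obtain ⟨hik, h1, rfl, rfl, rfl⟩ := h
        exact Or.inr (Or.inl ⟨hs, hik⟩)
      · obtain ⟨hik, rfl, rfl, rfl⟩ := h
        exact Or.inr (Or.inr ⟨hs, hik, hi⟩)
  · rintro (hπ | ⟨s, hs, rfl⟩)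
    · split_ifs at hπ with h
      · obtain ⟨rfl, rfl, rfl⟩ := h
        obtain rfl : π = [2, 1] := hπ
        exact ⟨_, _, .base, ⟨le_rfl, le_rfl, [2], [1], by simp⟩, rfl⟩
      · exact hπ.elim
    · exact (mem_pairs hk1 hl1 hs).choose_spec.choose_spec.choose_spec.2.2

theorem disjoint_base_child {k l b : ℕ} (hk1 : 1 ≤ k) (hl1 : 1 ≤ l) :
    Disjoint (if k = 1 ∧ l = 1 ∧ b = 0 then {[2, 1]} else ∅ : Set (List ℕ))
      (child '' (growPairs k l b ∪ budPairs k l b)) := by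
  split_ifs
  · rw [Set.disjoint_singleton_left]
    rintro ⟨s, hs, hs'⟩
    obtain ⟨k', l', b', h1, -⟩ := mem_pairs hk1 hl1 hs
    have h2 := h1.1.invariants.2.2.2.2
    have h3 := congrArg List.length hs'
    rw [child, length_insertBefore] at h3
    simp only [List.length_cons, List.length_nil] at h3
    omega
  · exact Set.empty_disjoint _

theorem disjoint_primitiveStates {k l b k' l' b' : ℕ} (h : ¬ (k = k' ∧ l = l' ∧ b = b')) :
    Disjoint (primitiveStates k l b) (primitiveStates k' l' b') := by
  rw [Set.disjoint_left]
  intro s hs hs'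
  have := hs.2.1.unique hs'.2.1
  exact h ⟨this.1, this.2, hs.2.2.symm.trans hs'.2.2⟩

theorem disjoint_growPairs_budPairs (k l b : ℕ) : Disjoint (growPairs k l b) (budPairs k l b) := by
  cases b with
  | zero => exact Set.disjoint_empty _
  | succ b =>
    rw [growPairs, budPairs, budRedPairs, budBluePairs, Set.disjoint_union_right]
    split_ifs
    all_goals
      constructor <;> refine Set.disjoint_prod.2 (Or.inl (disjoint_primitiveStates ?_)) <;> omega

theorem disjoint_budRedPairs_budBluePairs (k l b : ℕ) :
    Disjoint (budRedPairs k l b) (budBluePairs k l b) :=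
  Set.disjoint_prod.2 (Or.inl (disjoint_primitiveStates (by omega)))

theorem finite_primitiveStates_iff {k l b : ℕ} :
    (primitiveStates k l b).Finite ↔ (primitiveSet k l b).Finite := by
  rw [← image_fst_primitiveStates, Set.finite_image_iff (injOn_fst_primitiveStates k l b)]

theorem primitiveSet_zero_left (l b : ℕ) : primitiveSet 0 l b = ∅ := by
  refine Set.eq_empty_of_forall_notMem ?_
  rintro π ⟨A, B, -, h, -⟩
  exact absurd h.one_le_left (by omega)

theorem primitiveSet_zero_right (k b : ℕ) : primitiveSet k 0 b = ∅ := by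
  refine Set.eq_empty_of_forall_notMem ?_
  rintro π ⟨A, B, -, h, -⟩
  exact absurd h.one_le_right (by omega)

theorem finite_primitiveSet (k l b : ℕ) : (primitiveSet k l b).Finite := by
  induction hN : k + l + 2 * b using Nat.strong_induction_on generalizing k l b with
  | _ N ih =>
    rcases Nat.eq_zero_or_pos k with rfl | hk
    · rw [primitiveSet_zero_left]; exact Set.finite_empty
    rcases Nat.eq_zero_or_pos l with rfl | hl
    · rw [primitiveSet_zero_right]; exact Set.finite_empty
    have ih' : ∀ k' l' b', k' + l' + 2 * b' < N → (primitiveStates k' l' b').Finite :=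
      fun k' l' b' h => finite_primitiveStates_iff.2 (ih _ h _ _ _ rfl)
    rw [primitiveSet_eq hk hl]
    refine Set.Finite.union ?_ (Set.Finite.image _ (Set.Finite.union ?_ ?_))
    · split_ifs
      · exact Set.finite_singleton _
      · exact Set.finite_empty
    · rw [growPairs]
      split_ifs
      · exact (ih' _ _ _ (by omega)).prod (Set.finite_singleton _)
      · exact (ih' _ _ _ (by omega)).prod (Set.finite_singleton _)
    · cases b with
      | zero => exact Set.finite_empty
      | succ b =>
        exact ((ih' _ _ _ (by omega)).prod (Set.finite_Iio _)).union
          ((ih' _ _ _ (by omega)).prod (Set.finite_Ioo _ _))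

theorem finite_primitiveStates (k l b : ℕ) : (primitiveStates k l b).Finite :=
  finite_primitiveStates_iff.2 (finite_primitiveSet k l b)

theorem finite_growPairs (k l b : ℕ) : (growPairs k l b).Finite := by
  rw [growPairs]
  split_ifs
  · exact (finite_primitiveStates _ _ _).prod (Set.finite_singleton _)
  · exact (finite_primitiveStates _ _ _).prod (Set.finite_singleton _)

theorem finite_budRedPairs (k l b : ℕ) : (budRedPairs k l b).Finite :=
  (finite_primitiveStates _ _ _).prod (Set.finite_Iio _)

theorem finite_budBluePairs (k l b : ℕ) : (budBluePairs k l b).Finite :=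
  (finite_primitiveStates _ _ _).prod (Set.finite_Ioo _ _)

theorem finite_budPairs (k l : ℕ) : ∀ b, (budPairs k l b).Finite
  | 0 => Set.finite_empty
  | b + 1 => (finite_budRedPairs k l b).union (finite_budBluePairs k l b)

theorem ncard_growPairs (k l b : ℕ) : (growPairs k l b).ncard =
    if 2 ≤ k then numPrimitive (k - 1) l b else numPrimitive 1 (l - 1) b := by
  rw [growPairs]
  split_ifs <;> rw [Set.ncard_prod, Set.ncard_singleton, mul_one, ncard_primitiveStates]

theorem ncard_budPairs_succ (k l b : ℕ) : (budPairs k l (b + 1)).ncard =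
    (k + 1) * numPrimitive (k + 1) l b + l * numPrimitive k (l + 1) b := by
  rw [budPairs, Set.ncard_union_eq (disjoint_budRedPairs_budBluePairs k l b)
    (finite_budRedPairs k l b) (finite_budBluePairs k l b), budRedPairs, budBluePairs,
    Set.ncard_prod, Set.ncard_prod, ncard_primitiveStates, ncard_primitiveStates,
    ← Finset.coe_Iio, ← Finset.coe_Ioo, Set.ncard_coe_finset, Set.ncard_coe_finset,
    Nat.card_Iio, Nat.card_Ioo, mul_comm, mul_comm l]
  congr 2
  omega

/-- The recurrence obtained by classifying the last insertion. -/
theorem numPrimitive_eq {k l b : ℕ} (hk1 : 1 ≤ k) (hl1 : 1 ≤ l) :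
    numPrimitive k l b = (if k = 1 ∧ l = 1 ∧ b = 0 then 1 else 0) +
      ((if 2 ≤ k then numPrimitive (k - 1) l b else numPrimitive 1 (l - 1) b) +
        (budPairs k l b).ncard) := by
  have hinj : Set.InjOn child (growPairs k l b ∪ budPairs k l b) := by
    refine injOn_child.mono fun s hs => ?_
    obtain ⟨k', l', b', h1, h2, -⟩ := mem_pairs hk1 hl1 hs
    exact ⟨h1.1, h1.2.1.length_eq ▸ h2⟩
  have hfin := (finite_growPairs k l b).union (finite_budPairs k l b)
  rw [numPrimitive, primitiveSet_eq hk1 hl1, Set.ncard_union_eq (disjoint_base_child hk1 hl1) ?_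
    (hfin.image _), hinj.ncard_image, Set.ncard_union_eq (disjoint_growPairs_budPairs k l b)
    (finite_growPairs k l b) (finite_budPairs k l b), ncard_growPairs]
  · congr 1
    split_ifs <;> simp
  · split_ifs
    · exact Set.finite_singleton _
    · exact Set.finite_empty

theorem nPrim_of_lt_two {f b : ℕ} (hf : f < 2) : nPrim f b = 0 := by
  rw [nPrim, numPrimitive, show f - 1 = 0 by omega, primitiveSet_zero_right, Set.ncard_empty]

/-- The count depends only on the size of the active family and on the number of buds: both ways
of enlarging the family come from families of one size, and the `k + 1` reds and `l` blues that
can give a bud add up to `k + l + 1`. -/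
theorem numPrimitive_eq_nPrim {k l : ℕ} (b : ℕ) (hk1 : 1 ≤ k) (hl1 : 1 ≤ l) :
    numPrimitive k l b = nPrim (k + l) b := by
  induction hN : k + l + 2 * b using Nat.strong_induction_on generalizing k l b with
  | _ N ih =>
    rcases hk1.eq_or_lt with rfl | hk
    · rw [nPrim, Nat.add_sub_cancel_left]
    rw [nPrim, numPrimitive_eq hk1 hl1, numPrimitive_eq (k := 1) (l := k + l - 1) le_rfl (by omega),
      if_neg (show ¬ (k = 1 ∧ l = 1 ∧ b = 0) by omega), if_pos (show 2 ≤ k by omega),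
      if_neg (show ¬ (1 = 1 ∧ k + l - 1 = 1 ∧ b = 0) by omega), if_neg (show ¬ 2 ≤ 1 by omega),
      ih _ (by omega) b (by omega) hl1 rfl, nPrim, show k - 1 + l - 1 = k + l - 1 - 1 by omega]
    congr 2
    cases b with
    | zero => rfl
    | succ b =>
      rw [ncard_budPairs_succ, ncard_budPairs_succ, ih _ (by omega) b (by omega) hl1 rfl,
        ih _ (by omega) b (by omega) (by omega) rfl, ih _ (by omega) b (by omega) (by omega) rfl,
        ih _ (by omega) b (by omega) (by omega) rfl, show k + 1 + l = k + (l + 1) by omega,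
        show 1 + 1 + (k + l - 1) = k + (l + 1) by omega,
        show 1 + (k + l - 1 + 1) = k + (l + 1) by omega, ← add_mul, ← add_mul]
      congr 1
      omega

/-- The recurrence for types with a single red: `2` reds and `f - 1` blues can give the last bud. -/
theorem nPrim_recurrence {f : ℕ} (hf : 2 ≤ f) (b : ℕ) :
    nPrim f b = (if f = 2 ∧ b = 0 then 1 else 0) + nPrim (f - 1) b +
      if b = 0 then 0 else (f + 1) * nPrim (f + 1) (b - 1) := by
  have h : (1 = 1 ∧ f - 1 = 1 ∧ b = 0) ↔ (f = 2 ∧ b = 0) := by omega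
  rw [nPrim, numPrimitive_eq (k := 1) (l := f - 1) le_rfl (by omega),
    if_neg (show ¬ 2 ≤ 1 by omega), ← add_assoc, ← nPrim, if_congr h rfl rfl]
  congr 1
  cases b with
  | zero => simp [budPairs]
  | succ b =>
    rw [ncard_budPairs_succ, numPrimitive_eq_nPrim _ (by omega) (by omega),
      numPrimitive_eq_nPrim _ (by omega) (by omega), show 1 + 1 + (f - 1) = f + 1 by omega,
      show 1 + (f - 1 + 1) = f + 1 by omega, ← add_mul, if_neg (by omega), Nat.add_sub_cancel]
    congr 1
    omega

/-! ### Generating series -/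

/-- The number of partial matchings of `f + 2 j` points that leave `f` points unmatched. -/
def numMatchings (f j : ℕ) : ℕ := (f + 2 * j).choose f * Nat.doubleFactorial (2 * j - 1)

theorem numMatchings_zero_left (j : ℕ) :
    numMatchings 0 j = Nat.doubleFactorial (2 * j - 1) := by
  simp [numMatchings]

theorem numMatchings_zero_right (f : ℕ) : numMatchings f 0 = 1 := by
  simp [numMatchings]

theorem succ_mul_numMatchings (f j : ℕ) :
    (f + 1) * numMatchings (f + 1) j =
      (f + 2 * j + 1).choose f * Nat.doubleFactorial (2 * j + 1) := by
  have h := Nat.choose_succ_right_eq (f + 2 * j + 1) f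
  rw [show f + 2 * j + 1 - f = 2 * j + 1 by omega] at h
  have h2 : Nat.doubleFactorial (2 * j + 1) = (2 * j + 1) * Nat.doubleFactorial (2 * j - 1) := by
    cases j with
    | zero => rfl
    | succ j => exact Nat.doubleFactorial_add_two (2 * j + 1)
  rw [numMatchings, h2, show f + 1 + 2 * j = f + 2 * j + 1 by omega]
  linear_combination Nat.doubleFactorial (2 * j - 1) * h

theorem numMatchings_zero_succ (j : ℕ) : numMatchings 0 (j + 1) = numMatchings 1 j := by
  have h := succ_mul_numMatchings 0 j
  rw [zero_add, one_mul, Nat.choose_zero_right, one_mul] at h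
  rw [h, numMatchings_zero_left]
  rfl

/-- The last point is unmatched, or it is matched to one of the `f + 2` points that are unmatched
once it is deleted. -/
theorem numMatchings_succ_succ (f j : ℕ) : numMatchings (f + 1) (j + 1) =
    numMatchings f (j + 1) + (f + 2) * numMatchings (f + 2) j := by
  have h := succ_mul_numMatchings (f + 1) j
  rw [show f + 1 + 1 = f + 2 by omega] at h
  rw [h, numMatchings, numMatchings, show f + 1 + 2 * (j + 1) = (f + 2 * j + 2) + 1 by omega,
    Nat.choose_succ_succ, show f + 1 + 2 * j + 1 = f + 2 * j + 2 by omega,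
    show f + 2 * (j + 1) = f + 2 * j + 2 by omega, show 2 * (j + 1) - 1 = 2 * j + 1 by omega,
    add_mul]

/-- The generating series of the partial matchings with `f` unmatched points. -/
noncomputable def matchingSeries (f : ℕ) : PowerSeries ℚ :=
  PowerSeries.mk fun j => (numMatchings f j : ℚ)

/-- The generating series, by number of buds, of the primitive permutations with active family of
size `f`. -/
noncomputable def primSeries (f : ℕ) : PowerSeries ℚ := PowerSeries.mk fun b => (nPrim f b : ℚ)

theorem matchingSeries_zero :
    matchingSeries 0 = 1 + PowerSeries.X * matchingSeries 1 := by
  ext n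
  cases n with
  | zero => simp [matchingSeries, numMatchings]
  | succ n => simp [matchingSeries, PowerSeries.coeff_succ_X_mul, numMatchings_zero_succ,
      PowerSeries.coeff_one]

theorem matchingSeries_succ (f : ℕ) : matchingSeries (f + 1) = matchingSeries f +
    PowerSeries.X * (PowerSeries.C ((f + 2 : ℕ) : ℚ) * matchingSeries (f + 2)) := by
  ext n
  cases n with
  | zero => simp [matchingSeries, numMatchings]
  | succ n =>
    simp only [matchingSeries, PowerSeries.coeff_mk, map_add (PowerSeries.coeff _),
      PowerSeries.coeff_succ_X_mul, PowerSeries.coeff_C_mul, numMatchings_succ_succ]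
    push_cast
    ring

theorem primSeries_of_lt_two {f : ℕ} (hf : f < 2) : primSeries f = 0 := by
  ext n
  simp [primSeries, nPrim_of_lt_two hf]

theorem primSeries_succ {f : ℕ} (hf : 1 ≤ f) : primSeries (f + 1) =
    (if f = 1 then 1 else 0) + primSeries f +
      PowerSeries.X * (PowerSeries.C ((f + 2 : ℕ) : ℚ) * primSeries (f + 2)) := by
  ext n
  have h := nPrim_recurrence (f := f + 1) (by omega) n
  cases n with
  | zero =>
    have hC : PowerSeries.coeff 0 (if f = 1 then 1 else 0 : PowerSeries ℚ) =
        if f = 1 then 1 else 0 := by split_ifs <;> simp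
    simp only [primSeries, PowerSeries.coeff_mk, map_add (PowerSeries.coeff _),
      PowerSeries.coeff_zero_X_mul, hC, h]
    simp
  | succ n =>
    have hC : PowerSeries.coeff (n + 1) (if f = 1 then 1 else 0 : PowerSeries ℚ) = 0 := by
      split_ifs <;> simp [PowerSeries.coeff_one]
    simp only [primSeries, PowerSeries.coeff_mk, map_add (PowerSeries.coeff _),
      PowerSeries.coeff_succ_X_mul, PowerSeries.coeff_C_mul, hC, h]
    rw [if_neg (by omega), if_neg n.succ_ne_zero]
    simp only [Nat.add_sub_cancel]
    push_cast
    ring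

/-- The homogeneous recurrence has no nonzero solution in power series that vanishes at `f = 1`: the
coefficient of `t ^ b` at `f + 1` is determined by that of `t ^ b` at `f` and that of `t ^ (b - 1)`
at `f + 2`. -/
theorem eq_zero_of_recurrence {D : ℕ → PowerSeries ℚ} (h1 : D 1 = 0)
    (h : ∀ f, 1 ≤ f → D (f + 1) = D f +
      PowerSeries.X * (PowerSeries.C ((f + 2 : ℕ) : ℚ) * D (f + 2)))
    {f : ℕ} (hf : 1 ≤ f) : D f = 0 := by
  ext b
  rw [map_zero]
  induction b generalizing f with
  | zero =>
    induction f, hf using Nat.le_induction with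
    | base => simp [h1]
    | succ f hf ih => simpa [h f hf] using ih
  | succ b ihb =>
    induction f, hf using Nat.le_induction with
    | base => simp [h1]
    | succ f hf ih =>
      rw [h f hf, map_add, ih, PowerSeries.coeff_succ_X_mul, PowerSeries.coeff_C_mul,
        ihb (by omega), mul_zero, add_zero]

theorem primSeries_mul_matchingSeries_one {f : ℕ} (hf : 2 ≤ f) :
    primSeries f * matchingSeries 1 = matchingSeries f := by
  -- the recurrence for `primSeries` is homogeneous once its value at `f = 1` is taken to be `1`
  have := eq_zero_of_recurrence
    (D := fun f => (if f = 1 then 1 else primSeries f) * matchingSeries 1 - matchingSeries f)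
    (by simp) (fun f hf => ?_) (show 1 ≤ f by omega)
  · simp only [if_neg (show f ≠ 1 by omega)] at this
    exact sub_eq_zero.1 this
  · simp only [if_neg (show f + 1 ≠ 1 by omega), if_neg (show f + 2 ≠ 1 by omega),
      matchingSeries_succ f, primSeries_succ hf]
    split_ifs with hf1
    · rw [hf1, primSeries_of_lt_two (show 1 < 2 by omega)]
      ring
    · ring

theorem coeff_Phi (f : ℕ) :
    PowerSeries.coeff f Phi = HahnSeries.ofPowerSeries ℤ ℚ (primSeries f) := by
  rw [Phi, PowerSeries.coeff_mk, primSeries]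

theorem t_ne_zero : t ≠ 0 := HahnSeries.single_ne_zero one_ne_zero

/-- The ratio `y_2 / y_1` of two matching series, evaluated by running their recurrence down to
`f = 0`, where the matching series is the series of the double factorials. -/
theorem coeff_two_Phi : PowerSeries.coeff 2 Phi = phi := by
  obtain ⟨ι, hι⟩ : ∃ ι, ι = HahnSeries.ofPowerSeries ℤ ℚ := ⟨_, rfl⟩
  have hX : ι PowerSeries.X = t := hι ▸ HahnSeries.ofPowerSeries_X
  have hS : ι (matchingSeries 0) = pairings := by
    simp only [matchingSeries, numMatchings_zero_left, pairings, hι]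
  have h0 := congrArg ι matchingSeries_zero
  have h1 := congrArg ι (matchingSeries_succ 0)
  have h2 := congrArg ι (primSeries_mul_matchingSeries_one le_rfl)
  have hC : ι (PowerSeries.C ((0 + 2 : ℕ) : ℚ)) = 2 := by
    rw [map_natCast, map_natCast]; norm_num
  rw [map_add, map_mul, map_one, hS, hX] at h0
  rw [map_add, map_mul, map_mul, hS, hX, hC, zero_add] at h1
  rw [map_mul] at h2
  have hne : ∀ f, ι (matchingSeries f) ≠ 0 := by
    intro f hf
    have : matchingSeries f = 0 := HahnSeries.ofPowerSeries_injective (Γ := ℤ) (R := ℚ)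
      (by rw [← hι, hf, map_zero])
    have := congrArg (PowerSeries.coeff 0) this
    simp [matchingSeries, numMatchings_zero_right] at this
  have ht := t_ne_zero
  have hy := hne 1
  have hS0 : pairings ≠ 0 := hS ▸ hne 0
  have hS1 : 1 - 1 / pairings = t * ι (matchingSeries 1) / pairings := by
    field_simp
    rw [h0]
    ring
  have hφ : ι (primSeries 2) = ι (matchingSeries 2) / ι (matchingSeries 1) :=
    eq_div_of_mul_eq hy h2
  rw [coeff_Phi, ← hι, phi, hS1, hφ, ← HahnSeries.C_mul_eq_smul, map_div₀, map_one, map_ofNat]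
  have htwo : (2 : LaurentSeries ℚ) ≠ 0 := by
    rw [← map_ofNat (HahnSeries.C : ℚ →+* LaurentSeries ℚ) 2]
    exact HahnSeries.C_ne_zero two_ne_zero
  field_simp
  linear_combination -h1

theorem coeff_Phi_of_lt_two {n : ℕ} (hn : n < 2) : PowerSeries.coeff n Phi = 0 := by
  rw [coeff_Phi, primSeries_of_lt_two hn, map_zero]

/-- The differential equation, coefficient by coefficient. -/
theorem coeff_succ_Phi (n : ℕ) : (n + 2 : LaurentSeries ℚ) * PowerSeries.coeff (n + 2) Phi =
    1 / t * (PowerSeries.coeff (n + 1) Phi - PowerSeries.coeff n Phi) +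
      (if n = 0 then 2 * phi else 0) - if n = 1 then 1 / t else 0 := by
  cases n with
  | zero =>
    rw [coeff_two_Phi, coeff_Phi_of_lt_two (by omega), coeff_Phi_of_lt_two (by omega)]
    simp
  | succ n =>
    have h := congrArg (HahnSeries.ofPowerSeries ℤ ℚ) (primSeries_succ (f := n + 1) (by omega))
    have hC : HahnSeries.ofPowerSeries ℤ ℚ (if n + 1 = 1 then 1 else 0 : PowerSeries ℚ) =
        if n + 1 = 1 then 1 else 0 := by split_ifs <;> simp
    rw [map_add, map_add, map_mul, map_mul, map_natCast, map_natCast, HahnSeries.ofPowerSeries_X,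
      ← t, hC] at h
    have ht := t_ne_zero
    rw [if_neg n.succ_ne_zero, coeff_Phi, coeff_Phi, coeff_Phi, h]
    push_cast
    split_ifs <;> field_simp <;> ring

theorem derivative_Phi : PowerSeries.derivative (LaurentSeries ℚ) Phi =
    PowerSeries.C (1 / t) * (1 - PowerSeries.X) * Phi + 2 * PowerSeries.X * PowerSeries.C phi
      - PowerSeries.C (1 / t) * PowerSeries.X ^ 2 := by
  ext1 n
  have h2 : (2 : PowerSeries (LaurentSeries ℚ)) * PowerSeries.X * PowerSeries.C phi =
      PowerSeries.C (2 * phi) * PowerSeries.X := by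
    rw [map_mul, map_ofNat]
    ring
  rw [PowerSeries.coeff_derivative, h2, map_sub, map_add, mul_assoc, sub_mul, one_mul,
    PowerSeries.coeff_C_mul, map_sub, PowerSeries.coeff_C_mul, PowerSeries.coeff_C_mul,
    PowerSeries.coeff_X, PowerSeries.coeff_X_pow]
  cases n with
  | zero => simp [coeff_Phi_of_lt_two]
  | succ n =>
    have h := coeff_succ_Phi n
    rw [PowerSeries.coeff_succ_X_mul, show n + 1 + 1 = n + 2 from rfl, mul_comm]
    push_cast
    rw [show (n : LaurentSeries ℚ) + 1 + 1 = n + 2 by ring, h]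
    simp

theorem Phi_eq_X_sq_mul : ∃ G : PowerSeries (LaurentSeries ℚ),
    Phi = PowerSeries.X ^ 2 * G ∧ PowerSeries.constantCoeff G = phi := by
  obtain ⟨G, hG⟩ := PowerSeries.X_pow_dvd_iff.2 fun n (hn : n < 2) => coeff_Phi_of_lt_two hn
  refine ⟨G, hG, ?_⟩
  rw [← coeff_two_Phi, hG, ← PowerSeries.coeff_zero_eq_constantCoeff_apply]
  exact (PowerSeries.coeff_X_pow_mul G 2 0).symm

theorem coeff_Phi4 (m : ℤ) : Phi4.coeff m =
    if m + 4 < 0 then 0 else PowerSeries.coeff (m + 4).natAbs Phi := by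
  rw [Phi4, HahnSeries.coeff_single_mul, one_mul, PowerSeries.coeff_coe, sub_neg_eq_add]

theorem derivative_Phi4 : LaurentSeries.derivative (LaurentSeries ℚ) Phi4 =
    (x - x ^ 2 - 4 * C t) / (C t * x) * Phi4 + 2 / x ^ 3 * C phi - 1 / (C t * x ^ 2) := by
  have ht := t_ne_zero
  have hC : ∀ a, C a = HahnSeries.single 0 a := fun a => rfl
  have hCt : C t ≠ 0 := HahnSeries.single_ne_zero ht
  have hx : x ≠ 0 := HahnSeries.single_ne_zero one_ne_zero
  have hxinv : x⁻¹ = HahnSeries.single (-1) 1 := by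
    rw [x, HahnSeries.inv_single, inv_one]
  have key : (x - x ^ 2 - 4 * C t) / (C t * x) * Phi4 + 2 / x ^ 3 * C phi - 1 / (C t * x ^ 2) =
      C (1 / t) * Phi4 - (C (1 / t) * x) * Phi4 - (C 4 * x⁻¹) * Phi4 + C (2 * phi) * x⁻¹ ^ 3
        - C (1 / t) * x⁻¹ ^ 2 := by
    rw [map_mul, map_ofNat, map_ofNat, map_div₀, map_one]
    field_simp
  rw [key, hxinv, HahnSeries.single_pow, HahnSeries.single_pow, x, hC, hC, hC]
  simp only [HahnSeries.single_mul_single]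
  refine HahnSeries.ext (funext fun m => ?_)
  simp only [LaurentSeries.derivative_apply, LaurentSeries.hasseDeriv_coeff, HahnSeries.coeff_sub,
    HahnSeries.coeff_add, HahnSeries.coeff_single_mul, HahnSeries.coeff_single, coeff_Phi4]
  simp only [Ring.choose_one_right, Nat.cast_one, mul_one, one_pow, zero_add, sub_zero,
    zsmul_eq_mul, sub_neg_eq_add, show (3 • (-1 : ℤ)) = -3 from rfl,
    show (2 • (-1 : ℤ)) = -2 from rfl]
  rcases lt_or_ge m (-5) with hm | hm
  · simp [show m + 1 + 4 < 0 by omega, show m + 4 < 0 by omega, show m - 1 + 4 < 0 by omega,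
      show m ≠ -3 by omega, show m ≠ -2 by omega]
  obtain ⟨n, rfl⟩ : ∃ n : ℕ, m = n - 5 := ⟨(m + 5).toNat, by omega⟩
  match n with
  | 0 => simp [coeff_Phi_of_lt_two]
  | 1 => simp [coeff_Phi_of_lt_two]
  | n + 2 =>
    have h := coeff_succ_Phi n
    rw [if_neg (by omega), if_neg (by omega), if_neg (by omega),
      show (((n + 2 : ℕ) : ℤ) - 5 + 1 + 4).natAbs = n + 2 by omega,
      show (((n + 2 : ℕ) : ℤ) - 5 + 4).natAbs = n + 1 by omega,
      show (((n + 2 : ℕ) : ℤ) - 5 - 1 + 4).natAbs = n by omega]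
    have e0 : ((n + 2 : ℕ) : ℤ) - 5 = -3 ↔ n = 0 := by omega
    have e1 : ((n + 2 : ℕ) : ℤ) - 5 = -2 ↔ n = 1 := by omega
    simp only [e0, e1]
    push_cast
    linear_combination h

/-! ### The closed form as a solution of the differential equation -/

theorem hasDerivAt_psi (x : ℝ) : HasDerivAt psi (Real.exp (x ^ 2)) x := by
  have hc : Continuous fun y : ℝ => Real.exp (y ^ 2) := by fun_prop
  exact intervalIntegral.integral_hasDerivAt_right (hc.intervalIntegrable _ _)
    (hc.stronglyMeasurableAtFilter _ _) hc.continuousAt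

theorem closedForm_zero (c t : ℝ) : closedForm c t 0 = 0 := by
  simp [closedForm]

/-- The last summand of the closed form contributes `-(1 - t - 2tc)/t` to the inhomogeneous term, as
the exponential from `ψ'` cancels the exponential in front of `ψ`. -/
theorem hasDerivAt_closedForm (c : ℝ) {t : ℝ} (ht : 0 < t) (x : ℝ) :
    HasDerivAt (fun y : ℝ => closedForm c t y)
      ((1 - x) / t * closedForm c t x + 2 * x * c - x ^ 2 / t) x := by
  set s := Real.sqrt (2 * t) with hs
  have hs0 : 0 < s := Real.sqrt_pos.2 (by positivity)
  have hs2 : s ^ 2 = 2 * t := Real.sq_sqrt (by positivity)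
  have h1 : HasDerivAt (fun y : ℝ => 1 - y) (-1) x := by
    simpa using (hasDerivAt_id x).const_sub 1
  have hquad : HasDerivAt (fun y : ℝ => -(1 - y) ^ 2 / (2 * t)) ((1 - x) / t) x := by
    refine ((h1.pow 2).neg.div_const (2 * t)).congr_deriv ?_
    field_simp
    ring
  have hquad' : HasDerivAt (fun y : ℝ => (1 - (1 - y) ^ 2) / (2 * t)) ((1 - x) / t) x := by
    refine (((h1.pow 2).const_sub 1).div_const (2 * t)).congr_deriv ?_
    field_simp
    ring
  have hpsi : HasDerivAt (fun y : ℝ => psi ((1 - y) / s))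
      (Real.exp (((1 - x) / s) ^ 2) * (-1 / s)) x :=
    HasDerivAt.comp (h₂ := psi) x (hasDerivAt_psi ((1 - x) / s)) (h1.div_const s)
  have hexp : Real.exp (-(1 - x) ^ 2 / (2 * t)) * Real.exp (((1 - x) / s) ^ 2) = 1 := by
    rw [← Real.exp_add, div_pow, hs2, ← add_div]
    simp
  have h := (((hasDerivAt_id x).neg.add ((hquad'.exp.sub_const 1).mul_const (1 - 2 * t * c))).add
    (((hquad.exp.const_mul 2).mul (hpsi.sub_const (psi (1 / s)))).mul_const
      ((1 - t - 2 * t * c) / s)))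
  have hval : closedForm c t x = -x + (Real.exp ((1 - (1 - x) ^ 2) / (2 * t)) - 1) * (1 - 2 * t * c)
      + 2 * Real.exp (-(1 - x) ^ 2 / (2 * t)) * (psi ((1 - x) / s) - psi (1 / s))
        * ((1 - t - 2 * t * c) / s) := rfl
  rw [hval]
  refine h.congr_deriv ?_
  have hlast : 2 * Real.exp (-(1 - x) ^ 2 / (2 * t)) *
      (Real.exp (((1 - x) / s) ^ 2) * (-1 / s)) * ((1 - t - 2 * t * c) / s) =
      -(1 - t - 2 * t * c) / t := by
    have : 2 * Real.exp (-(1 - x) ^ 2 / (2 * t)) *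
      (Real.exp (((1 - x) / s) ^ 2) * (-1 / s)) * ((1 - t - 2 * t * c) / s) =
      (Real.exp (-(1 - x) ^ 2 / (2 * t)) * Real.exp (((1 - x) / s) ^ 2)) *
        (-2 * (1 - t - 2 * t * c) / s ^ 2) := by
      field_simp
    rw [this, hexp, hs2]
    field_simp
  rw [add_mul (2 * (Real.exp (-(1 - x) ^ 2 / (2 * t)) * _) * _), hlast]
  field_simp
  ring

theorem hasDerivAt_inv_pow_four_mul_closedForm (c : ℝ) {t : ℝ} (ht : 0 < t) {x : ℝ} (hx : x ≠ 0) :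
    HasDerivAt (fun y : ℝ => (y ^ 4)⁻¹ * closedForm c t y)
      ((x - x ^ 2 - 4 * t) / (t * x) * ((x ^ 4)⁻¹ * closedForm c t x)
        + 2 / x ^ 3 * c - 1 / (t * x ^ 2)) x := by
  have h := ((hasDerivAt_pow 4 x).fun_inv (pow_ne_zero 4 hx)).mul (hasDerivAt_closedForm c ht x)
  refine h.congr_deriv ?_
  field_simp
  ring

theorem tendsto_closedForm (c : ℝ) {t : ℝ} (ht : 0 < t) :
    Filter.Tendsto (fun x : ℝ => (x ^ 2)⁻¹ * closedForm c t x)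
      (nhdsWithin 0 {0}ᶜ) (nhds c) := by
  have hd := hasDerivAt_closedForm c ht
  have hcont : Continuous fun y : ℝ => closedForm c t y :=
    continuous_iff_continuousAt.2 fun x => (hd x).continuousAt
  -- the derivative at `0` vanishes
  have hslope : Filter.Tendsto (fun x : ℝ => x⁻¹ * closedForm c t x)
      (nhdsWithin 0 {0}ᶜ) (nhds 0) := by
    have := (hd 0).tendsto_slope_zero
    simpa [closedForm_zero] using this
  have hne : ∀ᶠ x : ℝ in nhdsWithin 0 {0}ᶜ, x ≠ 0 := eventually_mem_nhdsWithin
  have hquot : Filter.Tendsto (fun x : ℝ => closedForm c t x / x ^ 2)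
      (nhdsWithin 0 {0}ᶜ) (nhds c) := by
    refine HasDerivAt.lhopital_zero_nhdsNE (Filter.Eventually.of_forall hd)
      (Filter.Eventually.of_forall fun x => hasDerivAt_pow 2 x) ?_ ?_ ?_ ?_
    · filter_upwards [hne] with x hx
      simpa using hx
    · have := hcont.tendsto 0
      rw [closedForm_zero] at this
      exact this.mono_left nhdsWithin_le_nhds
    · have : Filter.Tendsto (fun x : ℝ => x ^ 2) (nhds 0) (nhds (0 ^ 2)) :=
        (continuous_pow 2).tendsto 0
      rw [zero_pow two_ne_zero] at this
      exact this.mono_left nhdsWithin_le_nhds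
    · have hlin : Filter.Tendsto (fun x : ℝ => (1 - x) / (2 * t)) (nhdsWithin 0 {0}ᶜ)
          (nhds ((1 - 0) / (2 * t))) :=
        (Continuous.tendsto (by fun_prop) 0).mono_left nhdsWithin_le_nhds
      have hlin' : Filter.Tendsto (fun x : ℝ => c - x / (2 * t)) (nhdsWithin 0 {0}ᶜ)
          (nhds (c - 0 / (2 * t))) :=
        (Continuous.tendsto (by fun_prop) 0).mono_left nhdsWithin_le_nhds
      have := (hlin.mul hslope).add hlin'
      rw [mul_zero, zero_add, zero_div, sub_zero] at this
      refine this.congr' ?_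
      filter_upwards [hne] with x hx
      field_simp
      ring
  refine hquot.congr fun x => ?_
  rw [div_eq_inv_mul]

/-! ### The Taylor expansion of the closed form -/

/-- The Taylor coefficients at `x = 0` of the solution of the differential equation that vanishes
at `0`, as polynomials in `t` (the variable `0`), `1/t` (the variable `1`) and the parameter `c`
(the variable `2`). -/
noncomputable def taylorCoeff : ℕ → MvPolynomial (Fin 3) ℚ
  | 0 => 0
  | 1 => 0
  | n + 2 => MvPolynomial.C (1 / (n + 2 : ℕ) : ℚ) *
      (MvPolynomial.X 1 * (taylorCoeff (n + 1) - taylorCoeff n) +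
        (if n = 0 then 2 * MvPolynomial.X 2 else 0) - if n = 1 then MvPolynomial.X 1 else 0)

/-- The recurrence behind the Taylor coefficients, in any `ℚ`-algebra, so that it applies to real
numbers and to Laurent series alike. -/
theorem aeval_taylorCoeff {R : Type*} [CommRing R] [Algebra ℚ R] (t s c : R) (n : ℕ) :
    (n + 2 : R) * MvPolynomial.aeval ![t, s, c] (taylorCoeff (n + 2)) =
      s * (MvPolynomial.aeval ![t, s, c] (taylorCoeff (n + 1)) -
        MvPolynomial.aeval ![t, s, c] (taylorCoeff n)) +
      (if n = 0 then 2 * c else 0) - if n = 1 then s else 0 := by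
  have h : (n + 2 : R) * algebraMap ℚ R (1 / (n + 2 : ℕ)) = 1 := by
    have h' : (n + 2 : R) = algebraMap ℚ R ((n + 2 : ℕ) : ℚ) := by
      rw [map_natCast]
      push_cast
      rfl
    rw [h', ← map_mul, mul_one_div_cancel (by positivity), map_one]
  rw [taylorCoeff, map_mul, MvPolynomial.aeval_C, ← mul_assoc, h, one_mul]
  split_ifs <;> simp [MvPolynomial.aeval_X]

theorem coeff_Phi_eq_aeval (n : ℕ) :
    PowerSeries.coeff n Phi = MvPolynomial.aeval ![t, 1 / t, phi] (taylorCoeff n) := by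
  induction n using Nat.strong_induction_on with
  | _ n ih =>
    match n with
    | 0 => rw [coeff_Phi_of_lt_two (by omega), taylorCoeff, map_zero]
    | 1 => rw [coeff_Phi_of_lt_two (by omega), taylorCoeff, map_zero]
    | n + 2 =>
      have hne : (n + 2 : LaurentSeries ℚ) ≠ 0 := by
        have := HahnSeries.C_ne_zero (Γ := ℤ) (R := ℚ) (r := ((n + 2 : ℕ) : ℚ))
          (by positivity)
        rw [map_natCast] at this
        exact_mod_cast this
      refine mul_left_cancel₀ hne ?_
      rw [aeval_taylorCoeff, coeff_succ_Phi, ih (n + 1) (by omega), ih n (by omega)]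

/-- The recurrence divides by `n + 2`, hence its solutions decrease faster than any geometric
sequence. -/
theorem exists_abs_mul_pow_le {α : ℕ → ℝ} {s c : ℝ}
    (hα : ∀ n : ℕ, (n + 2 : ℝ) * α (n + 2) = s * (α (n + 1) - α n) +
      (if n = 0 then 2 * c else 0) - if n = 1 then s else 0) {r : ℝ} (hr : 0 < r) :
    ∃ M, 0 ≤ M ∧ ∀ n, |α n| * r ^ n ≤ M := by
  obtain ⟨N, hN⟩ := exists_nat_ge (|s| * r + |s| * r ^ 2)
  -- from `N + 4` on, each term is at most the larger of the two before it
  set M := ∑ i ∈ Finset.range (N + 4), |α i| * r ^ i with hM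
  have hM0 : 0 ≤ M := Finset.sum_nonneg fun i _ => by positivity
  refine ⟨M, hM0, fun n => ?_⟩
  induction n using Nat.strong_induction_on with
  | _ n ih =>
    rcases lt_or_ge n (N + 4) with hn | hn
    · exact Finset.single_le_sum (f := fun i => |α i| * r ^ i) (fun i _ => by positivity)
        (Finset.mem_range.2 hn)
    · obtain ⟨n, rfl⟩ : ∃ m, n = m + 2 := ⟨n - 2, by omega⟩
      have h := hα n
      rw [if_neg (by omega), if_neg (by omega), add_zero, sub_zero] at h
      have h1 := ih (n + 1) (by omega)
      have h2 := ih n (by omega)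
      have habs : (n + 2 : ℝ) * |α (n + 2)| ≤ |s| * (|α (n + 1)| + |α n|) := by
        rw [← abs_of_pos (show (0 : ℝ) < n + 2 by positivity), ← abs_mul, h, abs_mul]
        gcongr
        exact abs_sub _ _
      have hNn : (N : ℝ) ≤ n := by exact_mod_cast (by omega : N ≤ n)
      have key : (n + 2 : ℝ) * (|α (n + 2)| * r ^ (n + 2)) ≤ (n + 2) * M := by
        calc (n + 2 : ℝ) * (|α (n + 2)| * r ^ (n + 2))
            = ((n + 2 : ℝ) * |α (n + 2)|) * r ^ (n + 2) := by ring
          _ ≤ (|s| * (|α (n + 1)| + |α n|)) * r ^ (n + 2) := by gcongr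
          _ = |s| * r * (|α (n + 1)| * r ^ (n + 1)) + |s| * r ^ 2 * (|α n| * r ^ n) := by ring
          _ ≤ |s| * r * M + |s| * r ^ 2 * M := by gcongr
          _ = (|s| * r + |s| * r ^ 2) * M := by ring
          _ ≤ (n + 2) * M := mul_le_mul_of_nonneg_right (by linarith) hM0
      exact le_of_mul_le_mul_left key (by positivity)

/-- Bounds on `|α n| r ^ n` for all `r` give convergence everywhere, also after multiplication by a
power of `n`: compare with the bound for the radius `2R`. -/
theorem summable_mul_pow {α : ℕ → ℝ} (hα : ∀ r : ℝ, 0 < r → ∃ M, 0 ≤ M ∧ ∀ n, |α n| * r ^ n ≤ M)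
    (k : ℕ) {R : ℝ} (hR : 0 < R) : Summable fun n : ℕ => (n : ℝ) ^ k * (|α n| * R ^ n) := by
  obtain ⟨M, hM0, hM⟩ := hα (2 * R) (by positivity)
  have hs := (summable_pow_mul_geometric_of_norm_lt_one k
    (r := (1 / 2 : ℝ)) (by norm_num)).mul_left M
  refine Summable.of_nonneg_of_le (fun n => by positivity) (fun n => ?_) hs
  have := hM n
  calc (n : ℝ) ^ k * (|α n| * R ^ n) = (n : ℝ) ^ k * (|α n| * (2 * R) ^ n) * (1 / 2) ^ n := by
        rw [mul_pow, div_pow, one_pow]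
        field_simp
    _ ≤ (n : ℝ) ^ k * M * (1 / 2) ^ n := by gcongr
    _ = M * ((n : ℝ) ^ k * (1 / 2) ^ n) := by ring

theorem summable_coeff_mul_pow {α : ℕ → ℝ}
    (hα : ∀ r : ℝ, 0 < r → ∃ M, 0 ≤ M ∧ ∀ n, |α n| * r ^ n ≤ M) (x : ℝ) :
    Summable fun n : ℕ => α n * x ^ n := by
  refine Summable.of_norm_bounded (summable_mul_pow hα 0 (R := |x| + 1) (by positivity))
    fun n => ?_
  rw [pow_zero, one_mul, norm_mul, norm_pow, Real.norm_eq_abs, Real.norm_eq_abs]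
  gcongr
  linarith

theorem hasDerivAt_tsum_coeff_mul_pow {α : ℕ → ℝ}
    (hα : ∀ r : ℝ, 0 < r → ∃ M, 0 ≤ M ∧ ∀ n, |α n| * r ^ n ≤ M) (x : ℝ) :
    HasDerivAt (fun y => ∑' n, α n * y ^ n) (∑' n : ℕ, α n * (n * x ^ (n - 1))) x ∧
      Summable fun n : ℕ => α n * (n * x ^ (n - 1)) := by
  set R := |x| + 1 with hR
  have hR1 : 1 ≤ R := by simp [hR]
  have hu := summable_mul_pow hα 1 (R := R) (by positivity)
  have hbound : ∀ (n : ℕ) (y : ℝ), y ∈ Metric.ball (0 : ℝ) R →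
      ‖α n * (n * y ^ (n - 1))‖ ≤ (n : ℝ) ^ 1 * (|α n| * R ^ n) := by
    intro n y hy
    rw [mem_ball_zero_iff, Real.norm_eq_abs] at hy
    rw [norm_mul, norm_mul, norm_pow, Real.norm_eq_abs, Real.norm_eq_abs, Real.norm_eq_abs,
      Nat.abs_cast, pow_one]
    have : |y| ^ (n - 1) ≤ R ^ n := by
      calc |y| ^ (n - 1) ≤ R ^ (n - 1) := by gcongr
        _ ≤ R ^ n := pow_le_pow_right₀ hR1 (Nat.sub_le _ _)
    calc |α n| * (n * |y| ^ (n - 1)) ≤ |α n| * (n * R ^ n) := by gcongr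
      _ = n * (|α n| * R ^ n) := by ring
  have hx : x ∈ Metric.ball (0 : ℝ) R := by
    rw [mem_ball_zero_iff, Real.norm_eq_abs]
    linarith
  exact ⟨hasDerivAt_tsum_of_isPreconnected hu Metric.isOpen_ball
    (convex_ball (0 : ℝ) R).isPreconnected
    (fun n y _ => (hasDerivAt_pow n y).const_mul (α n)) hbound hx
    (summable_coeff_mul_pow hα x) hx, Summable.of_norm_bounded hu fun n => hbound n x hx⟩

/-- A power series whose coefficients satisfy the recurrence is a solution of the differential
equation. -/
theorem hasDerivAt_tsum_of_recurrence {α : ℕ → ℝ} {s c : ℝ} (h0 : α 0 = 0) (h1 : α 1 = 0)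
    (hα : ∀ n : ℕ, (n + 2 : ℝ) * α (n + 2) = s * (α (n + 1) - α n) +
      (if n = 0 then 2 * c else 0) - if n = 1 then s else 0) (x : ℝ) :
    HasDerivAt (fun y => ∑' n, α n * y ^ n)
      (s * (1 - x) * (∑' n, α n * x ^ n) + 2 * x * c - s * x ^ 2) x := by
  have hb := fun r hr => exists_abs_mul_pow_le hα (r := r) hr
  obtain ⟨hd, hsum⟩ := hasDerivAt_tsum_coeff_mul_pow hb x
  refine hd.congr_deriv (HasSum.tsum_eq ?_)
  have hS := (summable_coeff_mul_pow hb x).hasSum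
  have hS1 : HasSum (fun n => α (n + 1) * x ^ (n + 1)) (∑' n, α n * x ^ n) := by
    have := (hasSum_nat_add_iff' 1).2 hS
    simpa [h0] using this
  have hE0 : HasSum (fun n : ℕ => if n = 0 then 2 * x * c else 0) (2 * x * c) :=
    hasSum_ite_eq 0 _
  have hE1 : HasSum (fun n : ℕ => if n = 1 then s * x ^ 2 else 0) (s * x ^ 2) :=
    hasSum_ite_eq 1 _
  have hE := (((hS1.sub (hS.mul_left x)).mul_left s).add hE0).sub hE1
  refine (hasSum_nat_add_iff' 2).1 ?_
  have hterm : ∀ n : ℕ, α (n + 2) * ((n + 2 : ℕ) * x ^ (n + 2 - 1)) =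
      s * (α (n + 1) * x ^ (n + 1) - x * (α n * x ^ n)) + (if n = 0 then 2 * x * c else 0) -
        if n = 1 then s * x ^ 2 else 0 := by
    intro n
    have h := hα n
    rw [show n + 2 - 1 = n + 1 by omega]
    push_cast
    calc α (n + 2) * ((n + 2) * x ^ (n + 1)) = ((n + 2 : ℝ) * α (n + 2)) * x ^ (n + 1) := by ring
      _ = _ := by
        rw [h]
        split_ifs with ha hb hb
        · omega
        · subst ha; ring
        · subst hb; ring
        · ring
  simp only [hterm]
  convert hE using 1
  simp [Finset.sum_range_succ, h1]
  ring

/-- Uniqueness of the solution of the initial value problem, by means of an integrating factor. -/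
theorem eq_of_hasDerivAt_linear {f g p q : ℝ → ℝ} {P : ℝ → ℝ} (hP : ∀ x, HasDerivAt P (p x) x)
    (hf : ∀ x, HasDerivAt f (p x * f x + q x) x) (hg : ∀ x, HasDerivAt g (p x * g x + q x) x)
    (h0 : f 0 = g 0) (x : ℝ) : f x = g x := by
  have hD : ∀ y, HasDerivAt (fun y => (f y - g y) * Real.exp (-P y)) 0 y := fun y =>
    (((hf y).sub (hg y)).mul (hP y).neg.exp).congr_deriv (by simp only [Pi.sub_apply]; ring)
  have := is_const_of_deriv_eq_zero (fun y => (hD y).differentiableAt) (fun y => (hD y).deriv) x 0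
  simp only [h0, sub_self, zero_mul, mul_eq_zero, Real.exp_ne_zero, or_false] at this
  exact sub_eq_zero.1 this

theorem hasSum_closedForm (c : ℝ) {t : ℝ} (ht : 0 < t) (x : ℝ) :
    HasSum (fun n : ℕ => MvPolynomial.aeval ![t, 1 / t, c] (taylorCoeff n) * x ^ n)
      (closedForm c t x) := by
  set α : ℕ → ℝ := fun n => MvPolynomial.aeval ![t, 1 / t, c] (taylorCoeff n) with hα
  have h0 : α 0 = 0 := by simp [hα, taylorCoeff]
  have h1 : α 1 = 0 := by simp [hα, taylorCoeff]
  have hrec := aeval_taylorCoeff t (1 / t) c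
  have hS := (summable_coeff_mul_pow (fun r hr => exists_abs_mul_pow_le (α := α) hrec hr) x).hasSum
  have hP : ∀ y : ℝ, HasDerivAt (fun y : ℝ => (y - y ^ 2 / 2) / t) ((1 - y) / t) y := fun y =>
    (((hasDerivAt_id y).sub ((hasDerivAt_pow 2 y).div_const 2)).div_const t).congr_deriv
      (by simp)
  have heq := eq_of_hasDerivAt_linear (f := fun y => ∑' n, α n * y ^ n)
    (g := fun y => closedForm c t y) (q := fun y => 2 * y * c - y ^ 2 / t) hP
    (fun y => (hasDerivAt_tsum_of_recurrence h0 h1 hrec y).congr_deriv (by ring))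
    (fun y => (hasDerivAt_closedForm c ht y).congr_deriv (by ring))
    (by
      rw [closedForm_zero, tsum_eq_single 0 fun n hn => by simp [hn]]
      simp [h0]) x
  rw [← heq]
  exact hS

theorem isExpansionAt_closedForm : IsExpansionAt closedForm phi Phi :=
  ⟨taylorCoeff, fun c _ x ht => hasSum_closedForm c ht x, coeff_Phi_eq_aeval⟩

end PrimPerm

theorem mainTheorem8 :
    -- the count depends only on the size of the active family and on the number of buds
    (∀ k l b : ℕ, 1 ≤ k → 1 ≤ l →
      (PrimPerm.primitiveSet k l b).Finite ∧
      PrimPerm.numPrimitive k l b = PrimPerm.nPrim (k + l) b) ∧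
    (∀ f b : ℕ, f < 2 → PrimPerm.nPrim f b = 0) ∧
    -- the boundary condition: `x⁻² Φ(x, t)` is a power series in `x` with value `φ(t)` at `x = 0`
    (∃ G : PowerSeries (LaurentSeries ℚ),
      PrimPerm.Phi = PowerSeries.X ^ 2 * G ∧ PowerSeries.constantCoeff G = PrimPerm.phi) ∧
    -- the differential equation for `x⁻⁴ Φ(x, t)`
    LaurentSeries.derivative (LaurentSeries ℚ) PrimPerm.Phi4 =
      (PrimPerm.x - PrimPerm.x ^ 2 - 4 * PrimPerm.C PrimPerm.t)
          / (PrimPerm.C PrimPerm.t * PrimPerm.x) * PrimPerm.Phi4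
        + 2 / PrimPerm.x ^ 3 * PrimPerm.C PrimPerm.phi
        - 1 / (PrimPerm.C PrimPerm.t * PrimPerm.x ^ 2) ∧
    -- the same equation, written for `Φ(x, t)`
    PowerSeries.derivative (LaurentSeries ℚ) PrimPerm.Phi =
      PowerSeries.C (1 / PrimPerm.t) * (1 - PowerSeries.X) * PrimPerm.Phi
        + 2 * PowerSeries.X * PowerSeries.C PrimPerm.phi
        - PowerSeries.C (1 / PrimPerm.t) * PowerSeries.X ^ 2 ∧
    -- the closed form
    PrimPerm.IsExpansionAt PrimPerm.closedForm PrimPerm.phi PrimPerm.Phi ∧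
    -- the closed form, as a function of `x`, solves the equation with the boundary condition
    (∀ c t : ℝ, 0 < t →
      (∀ x : ℝ, HasDerivAt (fun y : ℝ => PrimPerm.closedForm c t y)
        ((1 - x) / t * PrimPerm.closedForm c t x + 2 * x * c - x ^ 2 / t) x) ∧
      (∀ x : ℝ, x ≠ 0 → HasDerivAt (fun y : ℝ => (y ^ 4)⁻¹ * PrimPerm.closedForm c t y)
        ((x - x ^ 2 - 4 * t) / (t * x) * ((x ^ 4)⁻¹ * PrimPerm.closedForm c t x)
          + 2 / x ^ 3 * c - 1 / (t * x ^ 2)) x) ∧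
      Filter.Tendsto (fun x : ℝ => (x ^ 2)⁻¹ * PrimPerm.closedForm c t x)
        (nhdsWithin 0 {0}ᶜ) (nhds c)) := by
  refine ⟨fun k l b hk hl => ⟨PrimPerm.finite_primitiveSet k l b,
      PrimPerm.numPrimitive_eq_nPrim b hk hl⟩, fun f b hf => PrimPerm.nPrim_of_lt_two hf,
    PrimPerm.Phi_eq_X_sq_mul, PrimPerm.derivative_Phi4, PrimPerm.derivative_Phi,
    PrimPerm.isExpansionAt_closedForm, fun c t ht => ⟨PrimPerm.hasDerivAt_closedForm c ht,
      fun x hx => PrimPerm.hasDerivAt_inv_pow_four_mul_closedForm c ht hx,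
      PrimPerm.tendsto_closedForm c ht⟩⟩
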